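/- Let $d\ge 2$ be even. For a finite set $T\subset\mathbb{R}$ and $m\ge 2$ let $C_m(T)\subset\mathbb{R}^m$ be the convex hull of the points $(t,t^2,\dots,t^m)$, $t\in T$; if $|T|\ge m+1$, this is a cyclic $m$-polytope with $|T|$ vertices, and $C_m(n)$ denotes any such polytope with $n$ vertices. Let $f_k(P)$ be the number of $k$-dimensional faces of a polytope $P$. (1) Let $T_1,T_2\subset\mathbb{R}$ be disjoint finite sets with $n_j=|T_j|\ge d+1$, and let $P_j=C_d(T_j)$, $j=1,2$, be the corresponding cyclic $d$-polytopes; thus $P_1$ and $P_2$ have disjoint vertex sets on the moment curve. Let $P\subset\mathbb{R}^{d+1}$ be their Cayley polytope, the convex hull of $(P_1\times\{0\})\cup(P_2\times\{1\})$. Then $P$ is $\lfloor d/2\rfloor$-neighborly, i.e. any $j$ of its vertices, $1\le j\le\lfloor d/2\rfloor$, are the vertices of a $(j-1)$-dimensional face of $P$. If moreover $P$ is simplicial with the possible exception of its two facets $P_1\times\{0\}$ and $P_2\times\{1\}$ (every other proper face of $P$ is a simplex), then for all $1\le k\le d$ the Minkowski sum $P_1\oplus P_2$ satisfies $$f_{k-1}(P_1\oplus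 P_2)=f_k(C_{d+1}(n_1+n_2))-\sum_{i=0}^{\lfloor (d+1)/2\rfloor}\binom{d+1-i}{k+1-i}\left(\binom{n_1-d-2+i}{i}+\binom{n_2-d-2+i}{i}\right),$$ where $\binom{a}{b}=a(a-1)\cdots(a-b+1)/b!$ for integers $a$ and $b\ge 0$, and $\binom{a}{b}=0$ for $b<0$. (2) For all $n_1,n_2\ge d+1$ there are disjoint sets $T_1,T_2\subset\mathbb{R}$ with $|T_1|=n_1$, $|T_2|=n_2$ for which $P$ is simplicial with the possible exception of its two facets $P_1\times\{0\}$ and $P_2\times\{1\}$, so that the equalities above hold. -/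

import Mathlib

open scoped Pointwise

/-- The dimension of a non-empty set: the dimension of its affine hull. -/
noncomputable def affDim {E : Type*} [AddCommGroup E] [Module ℝ E] (F : Set E) : ℕ :=
  Module.finrank ℝ (vectorSpan ℝ F)

/-- `F` is a non-empty face of `P`: it is the set of points of `P` at which some linear functional
is maximal over `P`. The zero functional gives the trivial face `P` itself. -/
def IsFace {E : Type*} [AddCommGroup E] [Module ℝ E] [TopologicalSpace E] (P F : Set E) : Prop :=
  F.Nonempty ∧ IsExposed ℝ P F

/-- `f_k(P)`, the number of `k`-dimensional faces of `P`. -/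
noncomputable def faceCount {E : Type*} [AddCommGroup E] [Module ℝ E] [TopologicalSpace E]
    (P : Set E) (k : ℕ) : ℕ :=
  {F : Set E | IsFace P F ∧ affDim F = k}.ncard

/-- The vertices of `P`: the points that are faces. -/
def vertexSet {E : Type*} [AddCommGroup E] [Module ℝ E] [TopologicalSpace E]
    (P : Set E) : Set E :=
  {x | IsFace P {x}}

/-- `F` is a simplex: the convex hull of a finite affinely independent set of points. -/
def IsSimplex {E : Type*} [AddCommGroup E] [Module ℝ E] (F : Set E) : Prop :=
  ∃ s : Finset E, AffineIndependent ℝ ((↑) : s → E) ∧ F = convexHull ℝ (s : Set E)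

/-- `P` is `m`-neighborly: any `j` vertices of `P`, `1 ≤ j ≤ m`, are the vertices of a
`(j-1)`-dimensional face of `P`. -/
def IsNeighborly {E : Type*} [AddCommGroup E] [Module ℝ E] [TopologicalSpace E]
    (m : ℕ) (P : Set E) : Prop :=
  ∀ S : Finset E, S.Nonempty → (S : Set E) ⊆ vertexSet P → S.card ≤ m →
    IsFace P (convexHull ℝ (S : Set E)) ∧ affDim (convexHull ℝ (S : Set E)) + 1 = S.card

/-- The point `(t, t², …, t^d)` of the `d`-dimensional moment curve. -/
def momentCurve (d : ℕ) (t : ℝ) : Fin d → ℝ := fun i => t ^ ((i : ℕ) + 1)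

/-- The convex hull of the points of the moment curve with parameters in `T`. For `d ≥ 2` and
`d + 1 ≤ T.card` this is the cyclic `d`-polytope with `T.card` vertices. -/
def cyclicPolytope (d : ℕ) (T : Finset ℝ) : Set (Fin d → ℝ) :=
  convexHull ℝ (momentCurve d '' (T : Set ℝ))

/-- The copy of `P` in the hyperplane of height `c`, that is, `P × {c}`. -/
def liftAt {d : ℕ} (c : ℝ) (P : Set (Fin d → ℝ)) : Set (Fin (d + 1) → ℝ) :=
  (fun x : Fin d → ℝ => (Fin.snoc x c : Fin (d + 1) → ℝ)) '' P

/-- The Cayley polytope of `P₁` and `P₂`: the convex hull of `P₁ × {0}` and `P₂ × {1}`. -/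
def cayleyPolytope {d : ℕ} (P₁ P₂ : Set (Fin d → ℝ)) : Set (Fin (d + 1) → ℝ) :=
  convexHull ℝ (liftAt 0 P₁ ∪ liftAt 1 P₂)

/-- The Cayley polytope of `P₁` and `P₂` is simplicial, with the possible exception of its two
facets `P₁ × {0}` and `P₂ × {1}`. -/
def CayleySimplicial {d : ℕ} (P₁ P₂ : Set (Fin d → ℝ)) : Prop :=
  ∀ F : Set (Fin (d + 1) → ℝ), IsFace (cayleyPolytope P₁ P₂) F →
    F ≠ cayleyPolytope P₁ P₂ → F ≠ liftAt 0 P₁ → F ≠ liftAt 1 P₂ → IsSimplex F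

/-- The binomial coefficient of two integers: `a (a-1) ⋯ (a-b+1) / b!` for `b ≥ 0`, and `0` for
`b < 0`. -/
noncomputable def binom (a b : ℤ) : ℤ :=
  if 0 ≤ b then Ring.choose a b.toNat else 0

/-! A functional `l` on ℝ^d selects, in each of `T₁` and `T₂`, the parameters at which it is
maximal; their union is `topSet`, with a colour recording the side. The hypothesis on the Cayley
polytope says in effect that such a set has at most d+1 elements when `l ≠ 0`. Since Lagrange
interpolation prescribes `l` freely, up to a constant, on d+1 points of the moment curve, a mixed
set with k+1 elements is then the same as a (k-1)-face of the Minkowski sum. So f_{k-1}(P₁ ⊕ P₂) is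
the coefficient of X^(k+1) in the cardinality generating function M of `mixedFaces`, and
f_k(C_{d+1}(n₁+n₂)) is the same coefficient in its one-colour analogue A.

Put d = 2e and g_j = `gPoly e (n_j - d - 1)`. The formula is the coefficientwise form of A + 2 - M =
g₁ + g₂ (`mixedFaces_eq`). Let Q be the difference of the two sides. Its degree is at most 2e+1. It
is divisible by X^(e+1), because the form coming from the polynomial -∏(X-u)² makes every small set
of parameters a face, so that low coefficients merely count subsets. Finally Q(-1-X) = -Q, by the
Dehn-Sommerville equations for A, for M and for the two cyclic d-polytopes. Hence (X+1)^(e+1)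
divides Q as well, and a nonzero Q would have degree at least 2e+2.

The Dehn-Sommerville equations are proved once, for any number of colours. The relatively open
normal cones partition the space of functionals, and the signed dimension count (-1)^dim is additive
over such partitions. The closed cone of functionals whose top set contains a given nonempty G is
not a subspace, so its Euler characteristic vanishes; this is the Euler relation at G.

For existence, let `T₁` lie entirely to the left of `T₂`. By Rolle, the points selected in the two
sets force distinct roots of the derivative, which has degree at most d-1; so at most d+1 points are
selected. -/

section Euler

/-! ### Euler characteristic of polyhedral cones -/

variable {V : Type*} [AddCommGroup V] [Module ℝ V]

/-- The relatively open polyhedral cone on which the forms in `E` vanish and those in `J` are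
positive. -/
def openCone (E J : Finset (Module.Dual ℝ V)) : Set V :=
  {x | (∀ l ∈ E, l x = 0) ∧ ∀ l ∈ J, 0 < l x}

/-- A set that is a (possibly empty) relatively open polyhedral cone. -/
def IsOpenCone (U : Set V) : Prop := ∃ E J : Finset (Module.Dual ℝ V), U = openCone E J

open Classical in
/-- The Euler characteristic with compact support of a relatively open cone. -/
noncomputable def coneEuler (U : Set V) : ℤ :=
  if U = ∅ then 0 else (-1) ^ Module.finrank ℝ (Submodule.span ℝ U)

@[simp] lemma coneEuler_empty : coneEuler (∅ : Set V) = 0 := by simp [coneEuler]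

lemma coneEuler_of_mem {U : Set V} {x : V} (hx : x ∈ U) :
    coneEuler U = (-1) ^ Module.finrank ℝ (Submodule.span ℝ U) := by
  rw [coneEuler, if_neg (Set.nonempty_iff_ne_empty.1 ⟨x, hx⟩)]

lemma IsOpenCone.inter {U U' : Set V} (h : IsOpenCone U) (h' : IsOpenCone U') :
    IsOpenCone (U ∩ U') := by
  classical
  obtain ⟨E, J, rfl⟩ := h
  obtain ⟨E', J', rfl⟩ := h'
  refine ⟨E ∪ E', J ∪ J', ?_⟩
  ext x
  simp only [openCone, Set.mem_inter_iff, Set.mem_ofPred_eq, Finset.mem_union]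
  grind

lemma isOpenCone_pos (l : Module.Dual ℝ V) : IsOpenCone {x | 0 < l x} :=
  ⟨∅, {l}, by ext x; simp [openCone]⟩

lemma isOpenCone_neg (l : Module.Dual ℝ V) : IsOpenCone {x | l x < 0} :=
  ⟨∅, {-l}, by ext x; simp [openCone]⟩

lemma isOpenCone_zero (l : Module.Dual ℝ V) : IsOpenCone {x | l x = 0} :=
  ⟨{l}, ∅, by ext x; simp [openCone]⟩

lemma eventually_add_smul_pos (J : Finset (Module.Dual ℝ V)) {x : V} (hx : ∀ l ∈ J, 0 < l x)
    (w : V) : ∀ᶠ ε : ℝ in nhdsWithin 0 (Set.Ioi 0), ∀ l ∈ J, 0 < l (x + ε • w) := by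
  rw [Filter.eventually_all_finset]
  intro l hl
  have : Filter.Tendsto (fun ε : ℝ => l x + ε * l w) (nhds 0) (nhds (l x + 0 * l w)) :=
    Continuous.tendsto (by fun_prop) 0
  have hpos : (0 : ℝ) < l x + 0 * l w := by simpa using hx l hl
  have h := this.eventually (lt_mem_nhds hpos)
  filter_upwards [nhdsWithin_le_nhds h] with ε hε
  simpa using hε

lemma exists_add_smul_mem_openCone {E J : Finset (Module.Dual ℝ V)} {x w : V}
    (hx : x ∈ openCone E J) (hw : ∀ l ∈ E, l w = 0) :
    ∃ ε : ℝ, 0 < ε ∧ x + ε • w ∈ openCone E J := by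
  obtain ⟨ε, h, hε⟩ := ((eventually_add_smul_pos J hx.2 w).and self_mem_nhdsWithin).exists
  exact ⟨ε, hε, fun l hl => by simp [hx.1 l hl, hw l hl], h⟩

/-- From a point of the cone one can move a little in any direction killed by `E` without breaking
the strict inequalities, so the cone is open in that subspace. -/
lemma span_openCone {E J : Finset (Module.Dual ℝ V)} (h : (openCone E J).Nonempty) :
    (Submodule.span ℝ (openCone E J) : Set V) = {x | ∀ l ∈ E, l x = 0} := by
  obtain ⟨x, hx⟩ := h
  apply Set.Subset.antisymm
  · intro y hy
    induction hy using Submodule.span_induction with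
    | mem y hy => exact hy.1
    | zero => simp
    | add a b _ _ ha hb => intro l hl; simp [ha l hl, hb l hl]
    | smul c a _ ha => intro l hl; simp [ha l hl]
  · intro w hw
    obtain ⟨ε, hε, h⟩ := exists_add_smul_mem_openCone hx hw
    have h1 := Submodule.subset_span (R := ℝ) h
    have h2 := Submodule.subset_span (R := ℝ) hx
    have : w = ε⁻¹ • ((x + ε • w) - x) := by
      rw [add_sub_cancel_left, smul_smul, inv_mul_cancel₀ hε.ne', one_smul]
    rw [this]
    exact Submodule.smul_mem _ _ (Submodule.sub_mem _ h1 h2)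

lemma IsOpenCone.convex {U : Set V} (h : IsOpenCone U) {x y : V} (hx : x ∈ U) (hy : y ∈ U)
    {a b : ℝ} (ha : 0 < a) (hb : 0 < b) : a • x + b • y ∈ U := by
  obtain ⟨E, J, rfl⟩ := h
  refine ⟨fun l hl => by simp [hx.1 l hl, hy.1 l hl], fun l hl => ?_⟩
  have := hx.2 l hl
  have := hy.2 l hl
  simp only [map_add, map_smul, smul_eq_mul]
  positivity

variable [FiniteDimensional ℝ V]

/-- The slice is nonempty and `l` is nonzero on the span, so the span of the slice has codimension
one there. -/
lemma coneEuler_inter_zero {U : Set V} (hU : IsOpenCone U) (l : Module.Dual ℝ V) {x : V}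
    (hx : x ∈ U) (hlx : l x = 0) {w : V} (hw : w ∈ Submodule.span ℝ U) (hlw : l w ≠ 0) :
    coneEuler (U ∩ {y | l y = 0}) = - coneEuler U := by
  classical
  have hx0 : x ∈ U ∩ {y | l y = 0} := ⟨hx, hlx⟩
  rw [coneEuler_of_mem hx, coneEuler_of_mem hx0]
  obtain ⟨E, J, rfl⟩ := hU
  set W := Submodule.span ℝ (openCone E J) with hWdef
  have hW := span_openCone ⟨x, hx⟩
  have hU0 : openCone E J ∩ {y | l y = 0} = openCone (insert l E) J := by
    ext y; simp [openCone]; tauto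
  have hW0 : Submodule.span ℝ (openCone E J ∩ {y | l y = 0}) =
      (LinearMap.ker (l.domRestrict W)).map W.subtype := by
    apply SetLike.coe_injective
    rw [hU0, span_openCone ⟨x, hU0 ▸ hx0⟩]
    ext y
    have : y ∈ W ↔ ∀ l ∈ E, l y = 0 := by
      rw [← SetLike.mem_coe, hWdef, hW]; rfl
    simp [this, and_comm]
  rw [hW0, Submodule.finrank_map_subtype_eq]
  have hr := LinearMap.finrank_range_add_finrank_ker (l.domRestrict W)
  have hone : Module.finrank ℝ (LinearMap.range (l.domRestrict W)) = 1 := by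
    have hsurj : LinearMap.range (l.domRestrict W) = ⊤ := by
      rw [LinearMap.range_eq_top]
      apply LinearMap.surjective
      intro h0
      exact hlw (by simpa using LinearMap.congr_fun h0 ⟨w, hw⟩)
    rw [hsurj, finrank_top, Module.finrank_self]
  rw [← hr, hone, pow_add]
  ring

omit [FiniteDimensional ℝ V] in
lemma coneEuler_eq_of_subset {U U' : Set V} (h : U' ⊆ U) {x : V} (hx : x ∈ U')
    (hs : Submodule.span ℝ U ≤ Submodule.span ℝ U') : coneEuler U' = coneEuler U := by
  rw [coneEuler_of_mem hx, coneEuler_of_mem (h hx), le_antisymm (Submodule.span_mono h) hs]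

omit [FiniteDimensional ℝ V] in
lemma coneEuler_inter_pos {U : Set V} (hU : IsOpenCone U) (l : Module.Dual ℝ V) {x : V}
    (hx : x ∈ U) (hlx : 0 < l x) : coneEuler (U ∩ {y | 0 < l y}) = coneEuler U := by
  classical
  have hx0 : x ∈ U ∩ {y | 0 < l y} := ⟨hx, hlx⟩
  refine coneEuler_eq_of_subset Set.inter_subset_left hx0 ?_
  obtain ⟨E, J, rfl⟩ := hU
  have hU0 : openCone E J ∩ {y | 0 < l y} = openCone E (insert l J) := by
    ext y; simp [openCone]; tauto
  rw [hU0] at hx0 ⊢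
  apply le_of_eq
  apply SetLike.coe_injective
  rw [span_openCone ⟨x, hx⟩, span_openCone ⟨x, hx0⟩]

omit [FiniteDimensional ℝ V] in
lemma IsOpenCone.exists_inter_pos {U : Set V} (hU : IsOpenCone U) (l : Module.Dual ℝ V) {x : V}
    (hx : x ∈ U) (hlx : l x = 0) {w : V} (hw : w ∈ Submodule.span ℝ U) (hlw : l w ≠ 0) :
    ∃ y ∈ U, 0 < l y := by
  obtain ⟨E, J, rfl⟩ := hU
  rw [← SetLike.mem_coe, span_openCone ⟨x, hx⟩] at hw
  -- Scaling by `l w` fixes the sign: `l` grows by a positive multiple of `(l w)²` in this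
  -- direction.
  obtain ⟨ε, hε, h⟩ := exists_add_smul_mem_openCone (w := l w • w) hx
    (fun k hk => by simp [hw k hk])
  refine ⟨_, h, ?_⟩
  have : 0 < l w * l w := mul_self_pos.2 hlw
  simp only [map_add, map_smul, smul_eq_mul, hlx]
  positivity

/-- If the hyperplane properly crosses the cone, both halves have its dimension n and the slice has
dimension n-1; the identity is (-1)^n = 2(-1)^n + (-1)^(n-1). Otherwise the sign of `l` is constant
on the cone and only one piece is nonempty. -/
lemma coneEuler_split {U : Set V} (hU : IsOpenCone U) (l : Module.Dual ℝ V) :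
    coneEuler U = coneEuler (U ∩ {x | 0 < l x}) + coneEuler (U ∩ {x | l x = 0}) +
      coneEuler (U ∩ {x | l x < 0}) := by
  have hneg : U ∩ {x | l x < 0} = U ∩ {x | 0 < (-l) x} := by ext; simp
  rcases U.eq_empty_or_nonempty with rfl | ⟨x, hx⟩
  · simp
  by_cases h0 : ∃ x ∈ U, l x = 0
  · obtain ⟨x, hx, hlx⟩ := h0
    by_cases hw : ∃ w ∈ Submodule.span ℝ U, l w ≠ 0
    · obtain ⟨w, hw, hlw⟩ := hw
      obtain ⟨y, hy, hly⟩ := hU.exists_inter_pos l hx hlx hw hlw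
      obtain ⟨z, hz, hlz⟩ := hU.exists_inter_pos (-l) hx (by simp [hlx]) hw (by simpa using hlw)
      rw [hneg, coneEuler_inter_pos hU l hy hly, coneEuler_inter_pos hU (-l) hz hlz,
        coneEuler_inter_zero hU l hx hlx hw hlw]
      ring
    · push Not at hw
      have hz : ∀ y ∈ U, l y = 0 := fun y hy => hw y (Submodule.subset_span hy)
      have h1 : U ∩ {x | 0 < l x} = ∅ := by
        ext y; simp only [Set.mem_inter_iff, Set.mem_ofPred_eq, Set.mem_empty_iff_false, iff_false]
        rintro ⟨hy, h⟩; exact h.ne' (hz y hy)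
      have h2 : U ∩ {x | l x < 0} = ∅ := by
        ext y; simp only [Set.mem_inter_iff, Set.mem_ofPred_eq, Set.mem_empty_iff_false, iff_false]
        rintro ⟨hy, h⟩; exact h.ne (hz y hy)
      have h3 : U ∩ {x | l x = 0} = U := Set.inter_eq_left.2 hz
      rw [h1, h2, h3]; simp
  · push Not at h0
    have h3 : U ∩ {x | l x = 0} = ∅ := by
      ext y; simp only [Set.mem_inter_iff, Set.mem_ofPred_eq, Set.mem_empty_iff_false, iff_false]
      rintro ⟨hy, h⟩; exact h0 y hy h
    have hsame : ∀ y ∈ U, ∀ z ∈ U, 0 < l y → l z < 0 → False := by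
      intro y hy z hz hly hlz
      -- With weights `-l z` and `l y` the two values cancel, producing a point of the cone on the
      -- hyperplane.
      refine h0 _ (hU.convex hy hz (neg_pos.2 hlz) hly) ?_
      simp only [map_add, map_smul, smul_eq_mul]; ring
    rcases lt_or_gt_of_ne (h0 x hx) with h | h
    · have h1 : U ∩ {x | 0 < l x} = ∅ := by
        ext y; simp only [Set.mem_inter_iff, Set.mem_ofPred_eq, Set.mem_empty_iff_false, iff_false]
        rintro ⟨hy, h'⟩; exact hsame y hy x hx h' h
      rw [h1, h3, hneg, coneEuler_inter_pos hU (-l) hx (by simpa using h)]; simp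
    · have h1 : U ∩ {x | l x < 0} = ∅ := by
        ext y; simp only [Set.mem_inter_iff, Set.mem_ofPred_eq, Set.mem_empty_iff_false, iff_false]
        rintro ⟨hy, h'⟩; exact hsame x hx y hy h h'
      rw [h1, h3, coneEuler_inter_pos hU l hx h]; simp

/-- The induction runs over a list of forms whose signs decide, inside `U`, to which piece a point
belongs. Cutting along the first form makes its sign constant and removes it from the list; once the
list is empty, a single piece fills `U`. -/
lemma sum_coneEuler_of_sign {β : Type*} (L : List (Module.Dual ℝ V)) :
    ∀ (U : Set V) (s : Finset β) (S : β → Set V), IsOpenCone U → (∀ i ∈ s, IsOpenCone (S i)) →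
      (∀ x, x ∈ U ↔ ∃ i ∈ s, x ∈ S i) →
      (∀ i ∈ s, ∀ j ∈ s, ∀ x, x ∈ S i → x ∈ S j → i = j) →
      (∀ i ∈ s, ∀ x ∈ U, ∀ y ∈ U, (∀ l ∈ L, SignType.sign (l x) = SignType.sign (l y)) →
        x ∈ S i → y ∈ S i) →
      ∑ i ∈ s, coneEuler (S i) = coneEuler U := by
  induction L with
  | nil =>
    intro U s S _ _ hU hdis hsign
    rcases U.eq_empty_or_nonempty with rfl | ⟨x, hx⟩
    · rw [coneEuler_empty]
      refine Finset.sum_eq_zero fun i hi => ?_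
      have : S i = ∅ := by
        ext x; simpa using fun h => (hU x).2 ⟨i, hi, h⟩
      rw [this, coneEuler_empty]
    · obtain ⟨i, hi, hxi⟩ := (hU x).1 hx
      have hSi : S i = U := by
        ext y
        exact ⟨fun h => (hU y).2 ⟨i, hi, h⟩, fun h => hsign i hi x hx y h (by simp) hxi⟩
      rw [Finset.sum_eq_single_of_mem i hi, hSi]
      intro j hj hji
      have : S j = ∅ := by
        ext y
        simp only [Set.mem_empty_iff_false, iff_false]
        intro h
        exact hji (hdis j hj i hi y h (hSi ▸ (hU y).2 ⟨j, hj, h⟩))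
      rw [this, coneEuler_empty]
  | cons l L ih =>
    intro U s S hUo hSo hU hdis hsign
    have key : ∀ H : Set V, IsOpenCone H →
        (∀ x ∈ H, ∀ y ∈ H, SignType.sign (l x) = SignType.sign (l y)) →
        ∑ i ∈ s, coneEuler (S i ∩ H) = coneEuler (U ∩ H) := by
      intro H hH hs
      refine ih (U ∩ H) s (fun i => S i ∩ H) (hUo.inter hH) (fun i hi => (hSo i hi).inter hH) ?_ ?_
        ?_
      · intro x
        simp only [Set.mem_inter_iff, hU]
        grind
      · intro i hi j hj x hx hx'
        exact hdis i hi j hj x hx.1 hx'.1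
      · intro i hi x hx y hy h hxi
        refine ⟨hsign i hi x hx.1 y hy.1 ?_ hxi.1, hy.2⟩
        intro k hk
        rcases List.mem_cons.1 hk with rfl | hk
        · exact hs x hx.2 y hy.2
        · exact h k hk
    rw [coneEuler_split hUo l, Finset.sum_congr rfl fun i hi => coneEuler_split (hSo i hi) l,
      Finset.sum_add_distrib, Finset.sum_add_distrib,
      key _ (isOpenCone_pos l) fun x hx y hy => by rw [sign_pos hx, sign_pos hy],
      key _ (isOpenCone_neg l) fun x hx y hy => by rw [sign_neg hx, sign_neg hy],
      key _ (isOpenCone_zero l) fun x hx y hy => by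
        rw [show l x = 0 from hx, show l y = 0 from hy]]

/-- The Euler characteristic is additive over finite partitions into open cones. -/
lemma sum_coneEuler_of_partition {β : Type*} {U : Set V} {s : Finset β} {S : β → Set V}
    (hUo : IsOpenCone U) (hSo : ∀ i ∈ s, IsOpenCone (S i)) (hU : ∀ x, x ∈ U ↔ ∃ i ∈ s, x ∈ S i)
    (hdis : ∀ i ∈ s, ∀ j ∈ s, ∀ x, x ∈ S i → x ∈ S j → i = j) :
    ∑ i ∈ s, coneEuler (S i) = coneEuler U := by
  classical
  have hSo' := hSo
  choose! E J hEJ using hSo'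
  refine sum_coneEuler_of_sign (s.biUnion fun i => E i ∪ J i).toList U s S hUo hSo hU hdis ?_
  intro i hi x _ y _ h hx
  rw [hEJ i hi] at hx ⊢
  refine ⟨fun l hl => ?_, fun l hl => ?_⟩
  · have := h l (by simp only [Finset.mem_toList, Finset.mem_biUnion]; exact ⟨i, hi, by simp [hl]⟩)
    rw [hx.1 l hl, sign_zero] at this
    exact sign_eq_zero_iff.1 this.symm
  · have := h l (by simp only [Finset.mem_toList, Finset.mem_biUnion]; exact ⟨i, hi, by simp [hl]⟩)
    rw [sign_pos (hx.2 l hl)] at this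
    exact sign_eq_one_iff.1 this.symm

/-- Two finite partitions of the same set into open cones have the same Euler characteristic. -/
lemma sum_coneEuler_eq {β γ : Type*} {s : Finset β} {S : β → Set V} {t : Finset γ} {T : γ → Set V}
    (hSo : ∀ i ∈ s, IsOpenCone (S i)) (hTo : ∀ i ∈ t, IsOpenCone (T i))
    (hST : ∀ x, (∃ i ∈ s, x ∈ S i) ↔ ∃ i ∈ t, x ∈ T i)
    (hS : ∀ i ∈ s, ∀ j ∈ s, ∀ x, x ∈ S i → x ∈ S j → i = j)
    (hT : ∀ i ∈ t, ∀ j ∈ t, ∀ x, x ∈ T i → x ∈ T j → i = j) :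
    ∑ i ∈ s, coneEuler (S i) = ∑ j ∈ t, coneEuler (T j) := by
  have h1 : ∀ i ∈ s, ∑ j ∈ t, coneEuler (S i ∩ T j) = coneEuler (S i) := by
    intro i hi
    refine sum_coneEuler_of_partition (hSo i hi) (fun j hj => (hSo i hi).inter (hTo j hj)) ?_
      (fun j hj k hk x hx hx' => hT j hj k hk x hx.2 hx'.2)
    intro x
    have := hST x
    simp only [Set.mem_inter_iff]
    grind
  have h2 : ∀ j ∈ t, ∑ i ∈ s, coneEuler (S i ∩ T j) = coneEuler (T j) := by
    intro j hj
    refine sum_coneEuler_of_partition (hTo j hj) (fun i hi => (hSo i hi).inter (hTo j hj)) ?_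
      (fun i hi k hk x hx hx' => hS i hi k hk x hx.1 hx'.1)
    intro x
    have := hST x
    simp only [Set.mem_inter_iff]
    grind
  rw [← Finset.sum_congr rfl h1, Finset.sum_comm, Finset.sum_congr rfl h2]

/-- Translating along `x₀` gives `l` any value, so the half-space piece has full dimension and the
slice one less: the contributions cancel. -/
lemma coneEuler_inter_pos_add_inter_zero {D : Set V} (hD : IsOpenCone D) (l : Module.Dual ℝ V)
    {x₀ : V} (hl : l x₀ = 1) (hx₀ : ∀ x ∈ D, ∀ c : ℝ, x + c • x₀ ∈ D) :
    coneEuler (D ∩ {x | 0 < l x}) + coneEuler (D ∩ {x | l x = 0}) = 0 := by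
  rcases D.eq_empty_or_nonempty with rfl | ⟨x, hx⟩
  · simp
  rw [coneEuler_inter_pos hD l (hx₀ x hx (1 - l x)) (by simp [hl]),
    coneEuler_inter_zero hD l (hx₀ x hx (- l x)) (by simp [hl]) (w := x₀) ?_ (by simp [hl])]
  · ring
  · have := Submodule.sub_mem _ (Submodule.subset_span (R := ℝ) (hx₀ x hx 1))
      (Submodule.subset_span hx)
    simpa using this

omit [FiniteDimensional ℝ V] in
lemma isOpenCone_argmin (E I A : Finset (Module.Dual ℝ V)) :
    IsOpenCone {x | (∀ l ∈ E, l x = 0) ∧ (∀ l ∈ A, ∀ k ∈ A, l x = k x) ∧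
      ∀ l ∈ A, ∀ k ∈ I, k ∉ A → l x < k x} := by
  classical
  refine ⟨E ∪ (A ×ˢ A).image (fun q => q.1 - q.2),
    (A ×ˢ (I \ A)).image (fun q => q.2 - q.1), ?_⟩
  ext x
  simp only [openCone, Set.mem_ofPred_eq, Finset.mem_union, Finset.mem_image, Finset.mem_product,
    Finset.mem_sdiff, Prod.exists]
  constructor
  · rintro ⟨h1, h2, h3⟩
    refine ⟨?_, ?_⟩
    · rintro l (h | ⟨a, b, ⟨ha, hb⟩, rfl⟩)
      · exact h1 l h
      · simp [h2 a ha b hb]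
    · rintro l ⟨a, b, ⟨ha, hb, hb'⟩, rfl⟩
      simpa using h3 a ha b hb hb'
  · rintro ⟨h1, h2⟩
    refine ⟨fun l hl => h1 l (Or.inl hl), fun l hl k hk => ?_, fun l hl k hk hk' => ?_⟩
    · simpa [sub_eq_zero] using h1 _ (Or.inr ⟨l, k, ⟨hl, hk⟩, rfl⟩)
    · simpa using h2 _ ⟨l, k, ⟨hl, hk, hk'⟩, rfl⟩

/-- Refine by the set `A` of forms of `I` that are minimal at `x`, and by whether the minimum is
positive or zero. As all forms of `I` take the value 1 at `x₀`, translation along `x₀` preserves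
`A`, so the two pieces attached to each `A` cancel. -/
lemma sum_coneEuler_closedCone_of_eq_one {β : Type*} {E I : Finset (Module.Dual ℝ V)}
    (hI : I.Nonempty) {x₀ : V} (hE : ∀ l ∈ E, l x₀ = 0) (hx₀ : ∀ l ∈ I, l x₀ = 1)
    {s : Finset β} {S : β → Set V} (hSo : ∀ i ∈ s, IsOpenCone (S i))
    (hS : ∀ x, (∃ i ∈ s, x ∈ S i) ↔ (∀ l ∈ E, l x = 0) ∧ ∀ l ∈ I, 0 ≤ l x)
    (hdis : ∀ i ∈ s, ∀ j ∈ s, ∀ x, x ∈ S i → x ∈ S j → i = j) :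
    ∑ i ∈ s, coneEuler (S i) = 0 := by
  classical
  let D : Finset (Module.Dual ℝ V) → Set V := fun A =>
    {x | (∀ l ∈ E, l x = 0) ∧ (∀ l ∈ A, ∀ k ∈ A, l x = k x) ∧
      ∀ l ∈ A, ∀ k ∈ I, k ∉ A → l x < k x}
  have hD : ∀ A, IsOpenCone (D A) := isOpenCone_argmin E I
  let a : Finset (Module.Dual ℝ V) → Module.Dual ℝ V := fun A =>
    if h : A.Nonempty then h.choose else 0
  have ha : ∀ A, A.Nonempty → a A ∈ A := fun A h => by
    simp only [a, dif_pos h]; exact h.choose_spec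
  let T : Finset (Module.Dual ℝ V) × Bool → Set V := fun q =>
    D q.1 ∩ (if q.2 then {x | 0 < a q.1 x} else {x | a q.1 x = 0})
  let 𝒜 := I.powerset.filter Finset.Nonempty
  have h𝒜 : ∀ A ∈ 𝒜, A ⊆ I ∧ a A ∈ A := fun A hA => by
    simp only [𝒜, Finset.mem_filter, Finset.mem_powerset] at hA
    exact ⟨hA.1, ha A hA.2⟩
  have key : ∑ i ∈ s, coneEuler (S i) = ∑ q ∈ 𝒜 ×ˢ (Finset.univ : Finset Bool),
      coneEuler (T q) := by
    refine sum_coneEuler_eq hSo ?_ ?_ hdis ?_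
    · rintro ⟨A, b⟩ _
      cases b
      · exact (hD A).inter (isOpenCone_zero _)
      · exact (hD A).inter (isOpenCone_pos _)
    · intro x
      rw [hS]
      constructor
      · rintro ⟨h1, h2⟩
        obtain ⟨l₀, hl₀, hmin⟩ := I.exists_min_image (fun l => l x) hI
        have hA : I.filter (fun l => l x = l₀ x) ∈ 𝒜 := by
          simp only [𝒜, Finset.mem_filter, Finset.mem_powerset]
          exact ⟨Finset.filter_subset _ _, l₀, by simp [hl₀]⟩
        have hmem : x ∈ D (I.filter (fun l => l x = l₀ x)) := by
          refine ⟨h1, fun l hl k hk => ?_, fun l hl k hk hk' => ?_⟩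
          · rw [(Finset.mem_filter.1 hl).2, (Finset.mem_filter.1 hk).2]
          · rw [(Finset.mem_filter.1 hl).2]
            refine lt_of_le_of_ne (hmin k hk) fun h => hk' ?_
            simp [hk, h]
        have hax := (Finset.mem_filter.1 (h𝒜 _ hA).2)
        rcases (h2 _ hax.1).lt_or_eq with h | h
        · exact ⟨(I.filter (fun l => l x = l₀ x), true),
            Finset.mem_product.2 ⟨hA, Finset.mem_univ _⟩, hmem, by rw [if_pos rfl]; exact h⟩
        · exact ⟨(I.filter (fun l => l x = l₀ x), false),
            Finset.mem_product.2 ⟨hA, Finset.mem_univ _⟩, hmem, by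
              rw [if_neg Bool.false_ne_true]; exact h.symm⟩
      · rintro ⟨⟨A, b⟩, hq, hx, hb⟩
        simp only [Finset.mem_product, Finset.mem_univ, and_true] at hq
        obtain ⟨hAI, haA⟩ := h𝒜 A hq
        have h0 : 0 ≤ a A x := by
          cases b
          · exact (show a A x = 0 by simpa using hb).ge
          · exact (show 0 < a A x by simpa using hb).le
        refine ⟨hx.1, fun l hl => ?_⟩
        by_cases hlA : l ∈ A
        · rwa [hx.2.1 l hlA _ haA]
        · exact h0.trans (hx.2.2 _ haA l hl hlA).le
    · rintro ⟨A, b⟩ hq ⟨A', b'⟩ hq' x hx hx'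
      simp only [Finset.mem_product, Finset.mem_univ, and_true] at hq hq'
      obtain ⟨hAI, haA⟩ := h𝒜 A hq
      obtain ⟨hAI', haA'⟩ := h𝒜 A' hq'
      have hsub : ∀ A B, A ∈ 𝒜 → B ∈ 𝒜 → x ∈ D A → x ∈ D B → A ⊆ B := by
        intro A B hA hB hxA hxB l hl
        by_contra hlB
        have h1 := hxB.2.2 _ (h𝒜 B hB).2 l ((h𝒜 A hA).1 hl) hlB
        by_cases h2 : a B ∈ A
        · exact h1.ne (hxA.2.1 _ h2 _ hl)
        · exact h1.not_gt (hxA.2.2 _ hl _ ((h𝒜 B hB).1 (h𝒜 B hB).2) h2)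
      obtain rfl : A = A' := (hsub A A' hq hq' hx.1 hx'.1).antisymm (hsub A' A hq' hq hx'.1 hx.1)
      have h1 := hx.2
      have h2 := hx'.2
      cases b <;> cases b' <;> simp_all
  rw [key, Finset.sum_product]
  refine Finset.sum_eq_zero fun A hA => ?_
  obtain ⟨hAI, haA⟩ := h𝒜 A hA
  rw [Fintype.sum_bool]
  refine coneEuler_inter_pos_add_inter_zero (hD A) (a A) (hx₀ _ (hAI haA)) fun x hx c => ?_
  refine ⟨fun l hl => ?_, fun l hl k hk => ?_, fun l hl k hk hk' => ?_⟩
  · simp [hx.1 l hl, hE l hl]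
  · simp [hx.2.1 l hl k hk, hx₀ l (hAI hl), hx₀ k (hAI hk)]
  · simpa [hx₀ l (hAI hl), hx₀ k hk] using hx.2.2 l hl k hk hk'

/-- The Euler characteristic of a closed polyhedral cone which is not a linear subspace. -/
lemma sum_coneEuler_closedCone {β : Type*} {E I : Finset (Module.Dual ℝ V)}
    (hI : I.Nonempty) {x₀ : V} (hE : ∀ l ∈ E, l x₀ = 0) (hx₀ : ∀ l ∈ I, 0 < l x₀)
    {s : Finset β} {S : β → Set V} (hSo : ∀ i ∈ s, IsOpenCone (S i))
    (hS : ∀ x, (∃ i ∈ s, x ∈ S i) ↔ (∀ l ∈ E, l x = 0) ∧ ∀ l ∈ I, 0 ≤ l x)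
    (hdis : ∀ i ∈ s, ∀ j ∈ s, ∀ x, x ∈ S i → x ∈ S j → i = j) :
    ∑ i ∈ s, coneEuler (S i) = 0 := by
  classical
  -- Positive rescaling makes every form equal to 1 at `x₀` without changing the closed cone.
  refine sum_coneEuler_closedCone_of_eq_one (E := E)
    (I := I.image fun l => (l x₀)⁻¹ • l) (hI.image _) hE ?_ hSo ?_ hdis
  · intro l hl
    obtain ⟨k, hk, rfl⟩ := Finset.mem_image.1 hl
    simp [inv_mul_cancel₀ (hx₀ k hk).ne']
  · intro x
    rw [hS]
    simp only [Finset.mem_image, forall_exists_index, and_imp, forall_apply_eq_imp_iff₂]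
    refine and_congr_right fun _ => forall₂_congr fun l hl => ?_
    have := hx₀ l hl
    simp [this]

end Euler

/-! ### Coloured top sets, normal fans and the Dehn-Sommerville equations -/

section TopSets

open Polynomial

variable {V : Type*} [AddCommGroup V] [Module ℝ V] {α ι : Type*}
  (N : Finset α) (κ : α → ι) (v : α → Module.Dual ℝ V)

open Classical in
/-- The points of `N` at which the value of `p` is maximal among the points of the same colour. -/
noncomputable def topSet (p : V) : Finset α :=
  N.filter fun t => ∀ s ∈ N, κ s = κ t → v s p ≤ v t p

open Classical in
/-- The proper subsets of `N` of the form `topSet N κ v p`. -/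
noncomputable def topSets : Finset (Finset α) :=
  N.powerset.filter fun F => F ≠ N ∧ ∃ p, topSet N κ v p = F

open Classical in
/-- The non-empty subsets of the sets `topSet N κ v p`, `p ≠ 0`. -/
noncomputable def subTopSets : Finset (Finset α) :=
  N.powerset.filter fun G => G.Nonempty ∧ ∃ p ≠ 0, G ⊆ topSet N κ v p

/-- The generating function of a family of finite sets by cardinality. -/
noncomputable def cardPoly (𝒜 : Finset (Finset α)) : ℤ[X] := ∑ F ∈ 𝒜, X ^ F.card

/-- Every `topSet` is proper in each colour, and in general position. -/
structure IsSimplicialSystem : Prop where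
  exists_color : ∀ c, ∃ t ∈ N, κ t = c
  proper : ∀ p ≠ 0, ∀ c, ∃ s ∈ N, κ s = c ∧ s ∉ topSet N κ v p
  onto : ∀ p ≠ 0, ∀ y : α → ℝ, ∃ (q : V) (γ : ι → ℝ),
    ∀ t ∈ topSet N κ v p, v t q + γ (κ t) = y t

variable {N κ v}

lemma mem_topSet {p : V} {t : α} :
    t ∈ topSet N κ v p ↔ t ∈ N ∧ ∀ s ∈ N, κ s = κ t → v s p ≤ v t p := by
  classical
  unfold topSet
  exact Finset.mem_filter

lemma topSet_subset (p : V) : topSet N κ v p ⊆ N := by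
  classical exact Finset.filter_subset _ _

lemma topSet_zero : topSet N κ v 0 = N := by
  ext t; simp [mem_topSet]

lemma mem_topSets {F : Finset α} :
    F ∈ topSets N κ v ↔ F ≠ N ∧ ∃ p, topSet N κ v p = F := by
  simp only [topSets, Finset.mem_filter, Finset.mem_powerset, and_iff_right_iff_imp]
  rintro ⟨_, p, rfl⟩
  exact topSet_subset p

lemma mem_subTopSets {G : Finset α} :
    G ∈ subTopSets N κ v ↔ G.Nonempty ∧ ∃ p ≠ 0, G ⊆ topSet N κ v p := by
  simp only [subTopSets, Finset.mem_filter, Finset.mem_powerset, and_iff_right_iff_imp]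
  rintro ⟨_, p, _, h⟩
  exact h.trans (topSet_subset p)

lemma exists_mem_topSet (p : V) {c : ι} (hc : ∃ t ∈ N, κ t = c) :
    ∃ t ∈ topSet N κ v p, κ t = c := by
  classical
  obtain ⟨t, ht, htc⟩ := hc
  obtain ⟨s, hs, hmax⟩ := (N.filter (fun t => κ t = c)).exists_max_image (fun t => v t p)
    ⟨t, by simp [ht, htc]⟩
  obtain ⟨hsN, rfl⟩ := Finset.mem_filter.1 hs
  exact ⟨s, mem_topSet.2 ⟨hsN, fun u hu huc => hmax u (by simp [hu, huc])⟩, rfl⟩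

lemma eq_of_mem_topSet {p : V} {s t : α} (hs : s ∈ topSet N κ v p) (ht : t ∈ topSet N κ v p)
    (h : κ s = κ t) : v s p = v t p :=
  ((mem_topSet.1 ht).2 s (mem_topSet.1 hs).1 h).antisymm
    ((mem_topSet.1 hs).2 t (mem_topSet.1 ht).1 h.symm)

lemma lt_of_mem_topSet {p : V} {s t : α} (ht : t ∈ topSet N κ v p) (hs : s ∈ N)
    (hs' : s ∉ topSet N κ v p) (h : κ s = κ t) : v s p < v t p := by
  by_contra hle
  refine hs' (mem_topSet.2 ⟨hs, fun u hu hus => ?_⟩)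
  exact ((mem_topSet.1 ht).2 u hu (hus.trans h)).trans (not_lt.1 hle)

/-- A set which is constant in each colour and beats the other points of the same colour is the
top set, as soon as it meets every colour. -/
lemma topSet_eq_of {p : V} {F : Finset α} (hF : F ⊆ N) (hcol : ∀ s ∈ N, ∃ t ∈ F, κ t = κ s)
    (h1 : ∀ s ∈ F, ∀ t ∈ F, κ s = κ t → v s p = v t p)
    (h2 : ∀ t ∈ F, ∀ s ∈ N, s ∉ F → κ s = κ t → v s p < v t p) : topSet N κ v p = F := by
  ext t
  rw [mem_topSet]
  constructor
  · rintro ⟨htN, ht⟩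
    by_contra htF
    obtain ⟨s, hs, hst⟩ := hcol t htN
    exact (h2 s hs t htN htF hst.symm).not_ge (ht s (hF hs) hst)
  · intro ht
    refine ⟨hF ht, fun s hs hst => ?_⟩
    by_cases hsF : s ∈ F
    · exact (h1 s hsF t ht hst).le
    · exact (h2 t ht s hs hsF hst).le

variable (N κ v) in
noncomputable def eqForms (F : Finset α) : Finset (Module.Dual ℝ V) :=
  open Classical in ((F ×ˢ F).filter fun q => κ q.1 = κ q.2).image fun q => v q.1 - v q.2

variable (N κ v) in
noncomputable def gapForms (F : Finset α) : Finset (Module.Dual ℝ V) :=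
  open Classical in ((F ×ˢ (N \ F)).filter fun q => κ q.1 = κ q.2).image fun q => v q.1 - v q.2

lemma forall_eqForms {F : Finset α} {x : V} :
    (∀ l ∈ eqForms κ v F, l x = 0) ↔ ∀ s ∈ F, ∀ t ∈ F, κ s = κ t → v s x = v t x := by
  simp only [eqForms, Finset.mem_image, Finset.mem_filter, Finset.mem_product, Prod.exists,
    forall_exists_index, and_imp]
  constructor
  · intro h s hs t ht hst
    simpa [sub_eq_zero] using h _ s t hs ht hst rfl
  · rintro h _ s t hs ht hst rfl
    simp [h s hs t ht hst]

lemma forall_gapForms {F : Finset α} {P : Module.Dual ℝ V → Prop} :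
    (∀ l ∈ gapForms N κ v F, P l) ↔
      ∀ t ∈ F, ∀ s ∈ N, s ∉ F → κ s = κ t → P (v t - v s) := by
  classical
  simp only [gapForms, Finset.mem_image, Finset.mem_filter, Finset.mem_product, Prod.exists,
    forall_exists_index, and_imp, Finset.mem_sdiff]
  constructor
  · intro h t ht s hs hs' hst
    exact h _ t s ht hs hs' hst.symm rfl
  · rintro h _ t s ht hs hs' hst rfl
    exact h t ht s hs hs' hst.symm

/-- This is a relatively open cone of the normal fan: equalities inside the top set, strict
inequalities against the remaining points of the same colour. -/
lemma setOf_topSet_eq (p : V) :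
    {q | topSet N κ v q = topSet N κ v p} =
      openCone (eqForms κ v (topSet N κ v p)) (gapForms N κ v (topSet N κ v p)) := by
  ext q
  simp only [openCone, Set.mem_ofPred_eq, forall_eqForms, forall_gapForms, LinearMap.sub_apply,
    sub_pos]
  constructor
  · intro h
    rw [← h]
    exact ⟨fun s hs t ht => eq_of_mem_topSet hs ht, fun t ht s hs hs' => lt_of_mem_topSet ht hs hs'⟩
  · rintro ⟨h1, h2⟩
    exact topSet_eq_of (topSet_subset p) (fun s hs => exists_mem_topSet p ⟨s, hs, rfl⟩) h1 h2

lemma isOpenCone_topSet (p : V) : IsOpenCone {q | topSet N κ v q = topSet N κ v p} :=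
  ⟨_, _, setOf_topSet_eq p⟩

variable [FiniteDimensional ℝ V] [Fintype ι]

/-- Send `(q, γ)` to the values `v t q + γ (κ t)` on `F`. This map is onto by `honto`, and its
kernel projects isomorphically to `W`, since `γ` is determined by `q` as soon as `F` meets every
colour. -/
lemma finrank_eqForms {F : Finset α} (hcol : ∀ c, ∃ t ∈ F, κ t = c)
    (honto : ∀ y : α → ℝ, ∃ (q : V) (γ : ι → ℝ), ∀ t ∈ F, v t q + γ (κ t) = y t)
    {W : Submodule ℝ V} (hW : (W : Set V) = {x | ∀ s ∈ F, ∀ t ∈ F, κ s = κ t → v s x = v t x}) :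
    Module.finrank ℝ W + F.card = Module.finrank ℝ V + Fintype.card ι := by
  classical
  let Φ : V × (ι → ℝ) →ₗ[ℝ] (F → ℝ) := LinearMap.pi fun t =>
    (v t).comp (LinearMap.fst ℝ V (ι → ℝ)) +
      (LinearMap.proj (κ t)).comp (LinearMap.snd ℝ V (ι → ℝ))
  have hΦ : ∀ q γ t, Φ (q, γ) t = v t q + γ (κ t) := fun q γ t => rfl
  have hsurj : LinearMap.range Φ = ⊤ := by
    rw [LinearMap.range_eq_top]
    intro y
    obtain ⟨q, γ, h⟩ := honto fun t => if h : t ∈ F then y ⟨t, h⟩ else 0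
    refine ⟨(q, γ), ?_⟩
    ext t
    rw [hΦ, h t t.2, dif_pos t.2]
  have hker : (LinearMap.ker Φ).map (LinearMap.fst ℝ V (ι → ℝ)) = W := by
    apply SetLike.coe_injective
    rw [hW]
    ext x
    simp only [Submodule.map_coe, Set.mem_image, SetLike.mem_coe, LinearMap.mem_ker, Prod.exists,
      LinearMap.fst_apply, exists_and_right, exists_eq_right, Set.mem_ofPred_eq]
    constructor
    · rintro ⟨γ, h⟩ s hs t ht hst
      have h1 := congrFun h ⟨s, hs⟩
      have h2 := congrFun h ⟨t, ht⟩
      rw [hΦ] at h1 h2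
      simp only [Pi.zero_apply] at h1 h2
      rw [hst] at h1
      linarith
    · intro h
      choose u hu huc using hcol
      refine ⟨fun c => - v (u c) x, ?_⟩
      ext t
      rw [hΦ, h t t.2 (u (κ t)) (hu _) (huc _).symm]
      simp
  have hinj : Function.Injective ((LinearMap.fst ℝ V (ι → ℝ)).domRestrict (LinearMap.ker Φ)) := by
    rw [injective_iff_map_eq_zero]
    rintro ⟨⟨x, γ⟩, hx⟩ h0
    have h0 : x = 0 := h0
    subst h0
    have : γ = 0 := by
      ext c
      obtain ⟨t, ht, rfl⟩ := hcol c
      have := congrFun (LinearMap.mem_ker.1 hx) ⟨t, ht⟩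
      rw [hΦ] at this
      simpa using this
    simp [this]
  have h1 := LinearMap.finrank_range_add_finrank_ker Φ
  have h2 : Module.finrank ℝ W = Module.finrank ℝ (LinearMap.ker Φ) := by
    rw [← hker, ← LinearMap.range_domRestrict]
    exact LinearMap.finrank_range_of_inj hinj
  rw [hsurj, finrank_top, Module.finrank_prod, Module.finrank_fintype_fun_eq_card,
    Module.finrank_fintype_fun_eq_card, Fintype.card_coe] at h1
  omega

namespace IsSimplicialSystem

variable (h : IsSimplicialSystem N κ v)
include h

lemma coneEuler_topSet {p : V} (hp : p ≠ 0) :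
    coneEuler {q | topSet N κ v q = topSet N κ v p} =
      (-1) ^ (Module.finrank ℝ V + Fintype.card ι) * (-1) ^ (topSet N κ v p).card := by
  have hmem : p ∈ {q | topSet N κ v q = topSet N κ v p} := rfl
  rw [coneEuler_of_mem hmem]
  have hspan := setOf_topSet_eq (N := N) (κ := κ) (v := v) p
  have hW := span_openCone ⟨p, hspan ▸ hmem⟩
  rw [← hspan] at hW
  simp only [forall_eqForms] at hW
  have := finrank_eqForms (fun c => exists_mem_topSet p (h.exists_color c)) (h.onto p hp) hW
  rw [← this, pow_add, mul_assoc, ← pow_add, ← two_mul, pow_mul]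
  simp

omit [FiniteDimensional ℝ V] [Fintype ι] in
lemma topSet_eq_iff [Nonempty ι] {p : V} : topSet N κ v p = N ↔ p = 0 := by
  constructor
  · intro hN
    by_contra hp
    obtain ⟨s, hs, _, hs'⟩ := h.proper p hp (Classical.arbitrary ι)
    rw [hN] at hs'
    exact hs' hs
  · rintro rfl
    exact topSet_zero

/-- The cone belonging to `N` itself is the origin, which contributes the 1. -/
lemma sum_topSets [DecidableEq α] [Nonempty ι] (G : Finset α) (hG : G ⊆ N) :
    ∑ F ∈ (insert N (topSets N κ v)) with G ⊆ F, coneEuler {q | topSet N κ v q = F} =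
      (-1) ^ (Module.finrank ℝ V + Fintype.card ι) *
        ∑ F ∈ topSets N κ v with G ⊆ F, (-1) ^ F.card + 1 := by
  rw [Finset.filter_insert, if_pos hG, Finset.sum_insert]
  · rw [add_comm, Finset.mul_sum]
    congr 1
    · refine Finset.sum_congr rfl fun F hF => ?_
      obtain ⟨hFN, p, rfl⟩ := mem_topSets.1 (Finset.mem_filter.1 hF).1
      exact h.coneEuler_topSet fun hp => hFN (h.topSet_eq_iff.2 hp)
    · have : {q | topSet N κ v q = N} = {0} := Set.ext fun q => h.topSet_eq_iff
      rw [this, coneEuler_of_mem (Set.mem_singleton 0), Submodule.span_zero_singleton,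
        finrank_bot, pow_zero]
  · exact fun hN => (mem_topSets.1 (Finset.mem_filter.1 hN).1).1 rfl

-- Every subset of a top set can be isolated by a small perturbation. This expresses simpliciality,
-- and also supplies the interior point needed for the closed cone in `sum_neg_one_pow_of_mem`.
omit [FiniteDimensional ℝ V] [Fintype ι] in
lemma exists_peak {p : V} (hp : p ≠ 0) {G : Finset α} (hG : G ⊆ topSet N κ v p) :
    ∃ x : V, (∀ s ∈ G, ∀ t ∈ G, κ s = κ t → v s x = v t x) ∧
      ∀ t ∈ G, ∀ s ∈ N, s ∉ G → κ s = κ t → v s x < v t x := by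
  classical
  -- Up to a constant per colour, `q` is the indicator function of `G` on the top set, so adding `ε
  -- • q` lifts exactly `G`.
  obtain ⟨q, γ, hq⟩ := h.onto p hp fun t => if t ∈ G then 1 else 0
  have hJ : ∀ l ∈ gapForms N κ v (topSet N κ v p), 0 < l p := by
    rw [forall_gapForms]
    intro t ht s hs hs' hst
    simpa using lt_of_mem_topSet ht hs hs' hst
  obtain ⟨ε, hε, hε0⟩ := ((eventually_add_smul_pos _ hJ q).and self_mem_nhdsWithin).exists
  have hε0 : 0 < ε := hε0
  rw [forall_gapForms] at hε
  refine ⟨p + ε • q, fun s hs t ht hst => ?_, fun t ht s hs hs' hst => ?_⟩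
  · have h1 := hq s (hG hs)
    have h2 := hq t (hG ht)
    rw [if_pos hs, hst] at h1
    rw [if_pos ht] at h2
    simp [eq_of_mem_topSet (hG hs) (hG ht) hst, show v s q = v t q by linarith]
  · by_cases hsp : s ∈ topSet N κ v p
    · have h1 := hq s hsp
      have h2 := hq t (hG ht)
      rw [if_neg hs', hst] at h1
      rw [if_pos ht] at h2
      have : ε * v s q < ε * v t q := by
        apply mul_lt_mul_of_pos_left _ hε0
        linarith
      simpa [eq_of_mem_topSet hsp (hG ht) hst] using this
    · simpa using hε t (hG ht) s hs hsp hst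

/-- The normal cones of the `F ⊇ G` partition the closed cone of all `x` with `G ⊆ topSet N κ v x`,
which is not a subspace and so has Euler characteristic 0. -/
lemma sum_neg_one_pow_of_mem [DecidableEq α] [Nonempty ι] {G : Finset α} (hG : G ∈ subTopSets N κ v) :
    ∑ F ∈ topSets N κ v with G ⊆ F, (-1 : ℤ) ^ F.card =
      - (-1) ^ (Module.finrank ℝ V + Fintype.card ι) := by
  classical
  obtain ⟨⟨t₀, ht₀⟩, p, hp, hGp⟩ := mem_subTopSets.1 hG
  have hGN : G ⊆ N := hGp.trans (topSet_subset p)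
  obtain ⟨x₀, h1, h2⟩ := h.exists_peak hp hGp
  have hsum := h.sum_topSets G hGN
  have hzero : ∑ F ∈ (insert N (topSets N κ v)) with G ⊆ F,
      coneEuler {q | topSet N κ v q = F} = 0 := by
    refine sum_coneEuler_closedCone (E := eqForms κ v G) (I := gapForms N κ v G) ?_ (x₀ := x₀) ?_
      ?_ ?_ ?_ ?_
    · obtain ⟨s, hs, hsc, hs'⟩ := h.proper p hp (κ t₀)
      refine ⟨v t₀ - v s, ?_⟩
      have := (forall_gapForms (N := N) (κ := κ) (v := v) (F := G)
        (P := fun l => l ∈ gapForms N κ v G)).1 (fun l hl => hl)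
      exact this t₀ ht₀ s hs (fun h => hs' (hGp h)) hsc
    · exact forall_eqForms.2 h1
    · rw [forall_gapForms]
      intro t ht s hs hs' hst
      simpa using h2 t ht s hs hs' hst
    · intro F hF
      rw [Finset.mem_filter, Finset.mem_insert, mem_topSets] at hF
      have : ∃ p, topSet N κ v p = F := by
        rcases hF.1 with rfl | h
        · exact ⟨0, topSet_zero⟩
        · exact h.2
      obtain ⟨p, rfl⟩ := this
      exact isOpenCone_topSet p
    · intro x
      rw [forall_eqForms, forall_gapForms]
      simp only [Finset.mem_filter, Set.mem_ofPred_eq, LinearMap.sub_apply, sub_nonneg]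
      constructor
      · rintro ⟨F, ⟨_, hGF⟩, rfl⟩
        refine ⟨fun s hs t ht => eq_of_mem_topSet (hGF hs) (hGF ht), fun t ht s hs _ hst => ?_⟩
        exact (mem_topSet.1 (hGF ht)).2 s hs hst
      · rintro ⟨h3, h4⟩
        refine ⟨topSet N κ v x, ⟨?_, fun t ht => ?_⟩, rfl⟩
        · rw [Finset.mem_insert, mem_topSets]
          by_cases hx : topSet N κ v x = N
          · exact Or.inl hx
          · exact Or.inr ⟨hx, x, rfl⟩
        · refine mem_topSet.2 ⟨hGN ht, fun s hs hst => ?_⟩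
          by_cases hsG : s ∈ G
          · exact (h3 s hsG t ht hst).le
          · exact h4 t ht s hs hsG hst
    · intro F _ F' _ x hx hx'
      exact hx.symm.trans hx'
  rw [hzero] at hsum
  have hsq : ((-1 : ℤ) ^ (Module.finrank ℝ V + Fintype.card ι)) *
      (-1) ^ (Module.finrank ℝ V + Fintype.card ι) = 1 := by
    rw [← pow_add, ← two_mul, pow_mul]; simp
  generalize ((-1 : ℤ) ^ (Module.finrank ℝ V + Fintype.card ι)) = a at *
  generalize (∑ F ∈ topSets N κ v with G ⊆ F, (-1 : ℤ) ^ F.card) = b at *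
  linear_combination (-a) * hsum - b * hsq

/-- Here the normal cones partition all of `V`, whose Euler characteristic is `(-1)^dim V`. -/
lemma sum_neg_one_pow [Nonempty ι] :
    ∑ F ∈ topSets N κ v, (-1 : ℤ) ^ F.card =
      (-1) ^ (Module.finrank ℝ V + Fintype.card ι) * ((-1) ^ Module.finrank ℝ V - 1) := by
  classical
  have hsum := h.sum_topSets ∅ (Finset.empty_subset _)
  have hone : ∑ F ∈ (insert N (topSets N κ v)) with ∅ ⊆ F,
      coneEuler {q | topSet N κ v q = F} = (-1) ^ Module.finrank ℝ V := by
    rw [sum_coneEuler_of_partition (U := Set.univ) ⟨∅, ∅, by ext; simp [openCone]⟩]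
    · rw [coneEuler_of_mem (Set.mem_univ 0), Submodule.span_univ, finrank_top]
    · intro F hF
      rw [Finset.mem_filter, Finset.mem_insert, mem_topSets] at hF
      have : ∃ p, topSet N κ v p = F := by
        rcases hF.1 with rfl | h
        · exact ⟨0, topSet_zero⟩
        · exact h.2
      obtain ⟨p, rfl⟩ := this
      exact isOpenCone_topSet p
    · intro x
      simp only [Set.mem_univ, true_iff]
      refine ⟨topSet N κ v x, ?_, rfl⟩
      rw [Finset.mem_filter, Finset.mem_insert, mem_topSets]
      by_cases hx : topSet N κ v x = N
      · exact ⟨Or.inl hx, by simp⟩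
      · exact ⟨Or.inr ⟨hx, x, rfl⟩, by simp⟩
    · intro F _ F' _ x hx hx'
      exact hx.symm.trans hx'
  rw [hone] at hsum
  simp only [Finset.empty_subset, Finset.filter_true] at hsum
  have hsq : ((-1 : ℤ) ^ (Module.finrank ℝ V + Fintype.card ι)) *
      (-1) ^ (Module.finrank ℝ V + Fintype.card ι) = 1 := by
    rw [← pow_add, ← two_mul, pow_mul]; simp
  generalize ((-1 : ℤ) ^ (Module.finrank ℝ V + Fintype.card ι)) = a at *
  generalize (∑ F ∈ topSets N κ v, (-1 : ℤ) ^ F.card) = b at *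
  linear_combination (-a) * hsum - b * hsq

/-- The Dehn-Sommerville equations. -/
theorem dehnSommerville [Nonempty ι] :
    (cardPoly (topSets N κ v)).comp (-1 - X) =
      (-1) ^ (Module.finrank ℝ V + Fintype.card ι) *
        ((-1) ^ Module.finrank ℝ V - 1 - cardPoly (subTopSets N κ v)) := by
  classical
  -- Expanding (-1-X)^|F| over the subsets `G` of `F` and exchanging sums leaves, for each `G`, the
  -- alternating count of the `F ⊇ G` computed above.
  have hexp : ∀ F : Finset α, ((X : ℤ[X]) ^ F.card).comp (-1 - X) =
      ∑ G ∈ F.powerset, X ^ G.card * (-1) ^ F.card := by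
    intro F
    rw [← Finset.sum_mul]
    have := Finset.sum_pow_mul_eq_add_pow (X : ℤ[X]) 1 F
    simp only [one_pow, mul_one] at this
    rw [this, ← mul_pow, X_pow_comp]
    congr 1; ring
  rw [cardPoly, Polynomial.sum_comp, Finset.sum_congr rfl fun F _ => hexp F,
    Finset.sum_comm' (t' := insert ∅ (subTopSets N κ v))
      (s' := fun G => (topSets N κ v).filter fun F => G ⊆ F)]
  · have hsum : ∀ G, ∑ F ∈ topSets N κ v with G ⊆ F, (X : ℤ[X]) ^ G.card * (-1) ^ F.card =
        X ^ G.card * ((∑ F ∈ topSets N κ v with G ⊆ F, (-1 : ℤ) ^ F.card : ℤ) : ℤ[X]) := by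
      intro G
      rw [← Finset.mul_sum]
      push_cast
      rfl
    have hsub : ∀ G ∈ subTopSets N κ v, (X : ℤ[X]) ^ G.card *
        ((∑ F ∈ topSets N κ v with G ⊆ F, (-1 : ℤ) ^ F.card : ℤ) : ℤ[X]) =
        X ^ G.card * ((- (-1) ^ (Module.finrank ℝ V + Fintype.card ι) : ℤ) : ℤ[X]) :=
      fun G hG => by rw [h.sum_neg_one_pow_of_mem hG]
    rw [Finset.sum_congr rfl fun G _ => hsum G, Finset.sum_insert (by simp [mem_subTopSets]),
      Finset.sum_congr rfl hsub, ← Finset.sum_mul]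
    simp only [Finset.empty_subset, Finset.filter_true]
    rw [h.sum_neg_one_pow, cardPoly]
    push_cast
    simp only [Finset.card_empty, pow_zero]
    ring
  · intro F G
    simp only [Finset.mem_powerset, Finset.mem_filter, Finset.mem_insert]
    constructor
    · rintro ⟨hF, hGF⟩
      refine ⟨⟨hF, hGF⟩, ?_⟩
      rcases G.eq_empty_or_nonempty with hG | hG
      · exact Or.inl hG
      · obtain ⟨hFN, p, rfl⟩ := mem_topSets.1 hF
        exact Or.inr (mem_subTopSets.2
          ⟨hG, p, fun hp => hFN (h.topSet_eq_iff.2 hp), hGF⟩)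
    · rintro ⟨h1, _⟩
      exact h1

end IsSimplicialSystem

end TopSets

/-! ### Linear forms on the moment curve as polynomials -/

section MomentCurve

open Polynomial

/-- A polynomial of degree at most `m` is an affine form on the moment curve. -/
lemma exists_form_of_polynomial {m : ℕ} (p : ℝ[X]) (hp : p.natDegree ≤ m) :
    ∃ l : Module.Dual ℝ (Fin m → ℝ), ∀ t, l (momentCurve m t) + p.coeff 0 = p.eval t := by
  refine ⟨∑ i : Fin m, p.coeff (i + 1) • LinearMap.proj i, fun t => ?_⟩
  rw [eval_eq_sum_range' (Nat.lt_succ_of_le hp), Finset.sum_range_succ', Finset.sum_range]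
  simp [momentCurve]

lemma exists_polynomial_of_form {m : ℕ} {l : Module.Dual ℝ (Fin m → ℝ)} (hl : l ≠ 0) :
    ∃ p : ℝ[X], p.natDegree ≤ m ∧ p.derivative ≠ 0 ∧ ∀ t, p.eval t = l (momentCurve m t) := by
  have hcoeff : ∀ i : Fin m, (∑ j : Fin m, C (l (Pi.single j 1)) * X ^ ((j : ℕ) + 1)).coeff
      ((i : ℕ) + 1) = l (Pi.single i 1) := by
    intro i
    rw [finsetSum_coeff, Finset.sum_eq_single i]
    · simp
    · intro j _ hji
      rw [coeff_C_mul, coeff_X_pow, if_neg, mul_zero]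
      exact fun h => hji (Fin.ext (by omega))
    · simp
  refine ⟨∑ i : Fin m, C (l (Pi.single i 1)) * X ^ ((i : ℕ) + 1), ?_, ?_, fun t => ?_⟩
  · refine natDegree_sum_le_of_forall_le _ _ fun i _ => ?_
    exact (natDegree_C_mul_X_pow_le _ _).trans i.2
  · intro h0
    refine hl ((Pi.basisFun ℝ (Fin m)).ext fun i => ?_)
    have h1 := congrArg (fun q => q.coeff (i : ℕ)) h0
    simp only [coeff_derivative, coeff_zero, hcoeff] at h1
    have h2 : ((i : ℕ) : ℝ) + 1 ≠ 0 := by positivity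
    simpa [h2] using h1
  · rw [eval_finsetSum]
    have : momentCurve m t = ∑ i : Fin m, (t ^ ((i : ℕ) + 1)) • (Pi.single i (1 : ℝ)) := by
      ext j
      simp [momentCurve, Finset.sum_apply, Pi.single_apply]
    rw [this, map_sum]
    refine Finset.sum_congr rfl fun i _ => ?_
    rw [eval_mul, eval_C, eval_pow, eval_X, map_smul, smul_eq_mul, mul_comm]

/-- Along the curve `l` is a nonconstant polynomial of degree at most `m`, so it takes each value at
most `m` times. -/
lemma card_le_of_form_eq {m : ℕ} {l : Module.Dual ℝ (Fin m → ℝ)} (hl : l ≠ 0) {F : Finset ℝ}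
    (hF : ∀ s ∈ F, ∀ t ∈ F, l (momentCurve m s) = l (momentCurve m t)) : F.card ≤ m := by
  rcases F.eq_empty_or_nonempty with rfl | ⟨t₀, ht₀⟩
  · simp
  obtain ⟨p, hdeg, hder, hp⟩ := exists_polynomial_of_form hl
  have hne : p - C (p.eval t₀) ≠ 0 := by
    intro h
    apply hder
    rw [sub_eq_zero.1 h, derivative_C]
  have hsub : F.val ⊆ (p - C (p.eval t₀)).roots := by
    intro t ht
    rw [mem_roots hne, IsRoot, eval_sub, eval_C, hp, hp, hF t ht t₀ ht₀, sub_self]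
  have h1 := Multiset.card_le_card ((Multiset.le_iff_subset F.nodup).2 hsub)
  have h2 := card_roots' (p - C (p.eval t₀))
  rw [natDegree_sub_C] at h2
  exact (h1.trans h2).trans hdeg

lemma exists_form_interpolating {m : ℕ} {F : Finset ℝ} (hF : F.card ≤ m + 1) (y : ℝ → ℝ) :
    ∃ (l : Module.Dual ℝ (Fin m → ℝ)) (c : ℝ), ∀ t ∈ F, l (momentCurve m t) + c = y t := by
  classical
  have hinj : Set.InjOn (id : ℝ → ℝ) (F : Set ℝ) := Function.injective_id.injOn
  have hdeg : (Lagrange.interpolate F id y).natDegree ≤ m := by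
    rw [natDegree_le_iff_degree_le]
    refine (Lagrange.degree_interpolate_le y hinj).trans ?_
    exact_mod_cast (by omega : F.card - 1 ≤ m)
  obtain ⟨l, hl⟩ := exists_form_of_polynomial _ hdeg
  refine ⟨l, (Lagrange.interpolate F id y).coeff 0, fun t ht => ?_⟩
  rw [hl]
  exact Lagrange.eval_interpolate_at_node y hinj ht

/-- The polynomial -∏(X-u)² vanishes on `U`, is negative elsewhere, and has degree `2 * U.card`.
This is the source of all neighborliness below. -/
lemma exists_form_max_on {m : ℕ} {U : Finset ℝ} (hU : 2 * U.card ≤ m) :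
    ∃ (l : Module.Dual ℝ (Fin m → ℝ)) (c : ℝ), (∀ t ∈ U, l (momentCurve m t) = c) ∧
      ∀ t ∉ U, l (momentCurve m t) < c := by
  have hdeg : (-(∏ u ∈ U, (X - C u)) ^ 2 : ℝ[X]).natDegree ≤ m := by
    rw [natDegree_neg, natDegree_pow, natDegree_prod_of_monic _ _ fun u _ => monic_X_sub_C u]
    simpa using hU
  obtain ⟨l, hl⟩ := exists_form_of_polynomial _ hdeg
  simp only [eval_neg, eval_pow, eval_prod, eval_sub, eval_X, eval_C] at hl
  refine ⟨l, - (-(∏ u ∈ U, (X - C u)) ^ 2 : ℝ[X]).coeff 0, fun t ht => ?_, fun t ht => ?_⟩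
  · have := hl t
    rw [Finset.prod_eq_zero ht (sub_self t)] at this
    linarith
  · have := hl t
    have h2 : ∏ u ∈ U, (t - u) ≠ 0 :=
      Finset.prod_ne_zero_iff.2 fun u hu h => ht (by rwa [sub_eq_zero.1 h])
    have h3 : 0 < (∏ u ∈ U, (t - u)) ^ 2 := by positivity
    linarith

/-- Evaluation of linear forms at a point of the moment curve. -/
noncomputable def momentEval (m : ℕ) (t : ℝ) : Module.Dual ℝ (Module.Dual ℝ (Fin m → ℝ)) :=
  Module.Dual.eval ℝ (Fin m → ℝ) (momentCurve m t)

@[simp] lemma momentEval_apply (m : ℕ) (t : ℝ) (l : Module.Dual ℝ (Fin m → ℝ)) :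
    momentEval m t l = l (momentCurve m t) := rfl

lemma finrank_dual_fin (m : ℕ) : Module.finrank ℝ (Module.Dual ℝ (Fin m → ℝ)) = m := by
  rw [Subspace.dual_finrank_eq, Module.finrank_fin_fun]

section General

variable {ι : Type*} {N : Finset ℝ} {κ : ℝ → ι} {m : ℕ}

lemma card_topSet_color_le [DecidableEq ι] {l : Module.Dual ℝ (Fin m → ℝ)} (hl : l ≠ 0) (c : ι) :
    ((topSet N κ (momentEval m) l).filter fun t => κ t = c).card ≤ m := by
  refine card_le_of_form_eq hl fun s hs t ht => ?_
  rw [Finset.mem_filter] at hs ht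
  exact eq_of_mem_topSet hs.1 ht.1 (hs.2.trans ht.2.symm)

/-- General position comes from Lagrange interpolation through at most `m + 1` nodes; the same
additive constant serves all colours. -/
lemma isSimplicialSystem_momentEval [DecidableEq ι]
    (hcol : ∀ c, m + 1 ≤ (N.filter fun t => κ t = c).card)
    (hcard : ∀ l ≠ 0, (topSet N κ (momentEval m) l).card ≤ m + 1) :
    IsSimplicialSystem N κ (momentEval m) where
  exists_color c := by
    obtain ⟨t, ht⟩ := Finset.card_pos.1 ((Nat.succ_pos m).trans_le (hcol c))
    exact ⟨t, Finset.mem_filter.1 ht⟩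
  proper l hl c := by
    by_contra! h
    have hsub : (N.filter fun t => κ t = c) ⊆
        (topSet N κ (momentEval m) l).filter fun t => κ t = c := by
      intro t ht
      rw [Finset.mem_filter] at ht ⊢
      exact ⟨h t ht.1 ht.2, ht.2⟩
    have := (hcol c).trans ((Finset.card_le_card hsub).trans (card_topSet_color_le hl c))
    omega
  onto l hl y := by
    obtain ⟨q, γ, h⟩ := exists_form_interpolating (hcard l hl) y
    exact ⟨q, fun _ => γ, h⟩

lemma mem_topSets_of_two_mul_card_le {U : Finset ℝ} (hU : 2 * U.card ≤ m) (hUN : U ⊆ N)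
    (hcol : ∀ s ∈ N, ∃ t ∈ U, κ t = κ s) (hN : m < N.card) :
    U ∈ topSets N κ (momentEval m) := by
  obtain ⟨l, c, h1, h2⟩ := exists_form_max_on hU
  refine mem_topSets.2 ⟨?_, l, topSet_eq_of hUN hcol ?_ ?_⟩
  · rintro rfl; omega
  · intro s hs t ht _
    simp [h1 s hs, h1 t ht]
  · intro t ht s _ hs _
    simpa [h1 t ht] using h2 s hs

end General

/-- By `exists_peak` a subset of a top set is itself a top set unless it misses a colour, because a
top set always meets every colour. -/
lemma IsSimplicialSystem.mem_topSets_iff {V α ι : Type*} [AddCommGroup V] [Module ℝ V]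
    [Nonempty ι] {N : Finset α} {κ : α → ι} {v : α → Module.Dual ℝ V}
    (h : IsSimplicialSystem N κ v) {G : Finset α} :
    G ∈ topSets N κ v ↔ G ∈ subTopSets N κ v ∧ ∀ c, ∃ t ∈ G, κ t = c := by
  rw [mem_topSets, mem_subTopSets]
  constructor
  · rintro ⟨hN, p, rfl⟩
    have hcol := fun c => exists_mem_topSet (v := v) p (h.exists_color c)
    obtain ⟨t, ht, _⟩ := hcol (Classical.arbitrary ι)
    exact ⟨⟨⟨t, ht⟩, p, fun hp => hN (h.topSet_eq_iff.2 hp), subset_rfl⟩, hcol⟩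
  · rintro ⟨⟨_, p, hp, hG⟩, hcol⟩
    obtain ⟨x, h1, h2⟩ := h.exists_peak hp hG
    refine ⟨?_, x, topSet_eq_of (hG.trans (topSet_subset p)) (fun s _ => hcol (κ s)) h1 h2⟩
    rintro rfl
    exact hp (h.topSet_eq_iff.1 ((topSet_subset p).antisymm hG))

lemma cardPoly_sub_dvd {α : Type*} {𝒜 ℬ : Finset (Finset α)} (h : 𝒜 ⊆ ℬ) {e : ℕ}
    (he : ∀ F ∈ ℬ, F.card ≤ e → F ∈ 𝒜) : X ^ (e + 1) ∣ cardPoly ℬ - cardPoly 𝒜 := by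
  classical
  have : cardPoly ℬ - cardPoly 𝒜 = ∑ F ∈ ℬ \ 𝒜, X ^ F.card := by
    rw [cardPoly, cardPoly, ← Finset.sum_sdiff h]; ring
  rw [this]
  refine Finset.dvd_sum fun F hF => pow_dvd_pow _ ?_
  rw [Finset.mem_sdiff] at hF
  by_contra hlt
  exact hF.2 (he F hF.1 (by omega))

lemma cardPoly_powerset {α : Type*} (N : Finset α) :
    cardPoly N.powerset = (1 + X) ^ N.card := by
  classical
  have := Finset.sum_pow_mul_eq_add_pow (X : ℤ[X]) 1 N
  simp only [one_pow, mul_one] at this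
  rw [cardPoly, this, add_comm]

lemma cardPoly_coeff {α : Type*} (𝒜 : Finset (Finset α)) (k : ℕ) :
    (cardPoly 𝒜).coeff k = (𝒜.filter fun F => F.card = k).card := by
  rw [cardPoly, finsetSum_coeff, Finset.card_filter]
  simp [coeff_X_pow, eq_comm]

lemma cardPoly_natDegree_le {α : Type*} {𝒜 : Finset (Finset α)} {k : ℕ}
    (h : ∀ F ∈ 𝒜, F.card ≤ k) : (cardPoly 𝒜).natDegree ≤ k := by
  refine natDegree_sum_le_of_forall_le _ _ fun F hF => ?_
  rw [natDegree_X_pow]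
  exact h F hF

/-! ### Faces of a cyclic polytope -/

section OneColor

/-- The sets of parameters of the proper faces of a cyclic polytope. -/
noncomputable def cyclicFaces (m : ℕ) (T : Finset ℝ) : Finset (Finset ℝ) :=
  topSets T (fun _ => ()) (momentEval m)

variable {m : ℕ} {T : Finset ℝ}

lemma isSimplicialSystem_cyclic (hT : m + 1 ≤ T.card) :
    IsSimplicialSystem T (fun _ => ()) (momentEval m) := by
  refine isSimplicialSystem_momentEval (fun c => by simpa using hT) fun l hl => ?_
  have := card_topSet_color_le (N := T) (κ := fun _ => ()) hl ()
  simp only [Finset.filter_true] at this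
  omega

lemma card_le_of_mem_cyclicFaces {F : Finset ℝ} (hF : F ∈ cyclicFaces m T) : F.card ≤ m := by
  obtain ⟨hFT, l, rfl⟩ := mem_topSets.1 hF
  have hl : l ≠ 0 := fun h => hFT (h ▸ topSet_zero)
  have := card_topSet_color_le (N := T) (κ := fun _ => ()) hl ()
  simpa using this

lemma cyclic_dehnSommerville (hT : m + 1 ≤ T.card) :
    (cardPoly (cyclicFaces m T)).comp (-1 - X) =
      (-1) ^ (m + 1) * ((-1) ^ m - 1 - cardPoly (cyclicFaces m T)) := by
  have h := isSimplicialSystem_cyclic hT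
  have h1 : subTopSets T (fun _ => ()) (momentEval m) = cyclicFaces m T := by
    ext G
    rw [cyclicFaces, h.mem_topSets_iff, iff_self_and, mem_subTopSets]
    rintro ⟨⟨t, ht⟩, _⟩ c
    exact ⟨t, ht, rfl⟩
  have := h.dehnSommerville
  rwa [finrank_dual_fin, h1, Fintype.card_unit] at this

lemma cyclic_neighborly (hT : m + 1 ≤ T.card) {e : ℕ} (he : 2 * e ≤ m) :
    X ^ (e + 1) ∣ (1 + X) ^ T.card - (cardPoly (cyclicFaces m T) + 1) := by
  classical
  have h := isSimplicialSystem_cyclic hT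
  have hempty : ∅ ∉ cyclicFaces m T := fun h0 => by
    obtain ⟨t, ht, _⟩ := (h.mem_topSets_iff.1 h0).2 ()
    simp at ht
  have : cardPoly (cyclicFaces m T) + 1 = cardPoly (insert ∅ (cyclicFaces m T)) := by
    rw [cardPoly, cardPoly, Finset.sum_insert hempty]
    simp [add_comm]
  rw [this, ← cardPoly_powerset]
  refine cardPoly_sub_dvd ?_ fun F hF hFe => ?_
  · intro F hF
    rw [Finset.mem_powerset]
    rcases Finset.mem_insert.1 hF with rfl | hF
    · simp
    · obtain ⟨_, l, rfl⟩ := mem_topSets.1 hF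
      exact topSet_subset l
  · rw [Finset.mem_insert]
    rcases F.eq_empty_or_nonempty with h0 | ⟨t, ht⟩
    · exact Or.inl h0
    · exact Or.inr (mem_topSets_of_two_mul_card_le (by omega) (Finset.mem_powerset.1 hF)
        (fun s _ => ⟨t, ht, rfl⟩) (by omega))

end OneColor

/-! ### Faces of the sum of two cyclic polytopes -/

section TwoColors

/-- The colouring of the points of `T₁ ∪ T₂` that distinguishes `T₁` from `T₂`. -/
noncomputable def sideColor (T₁ : Finset ℝ) (t : ℝ) : Bool := decide (t ∈ T₁)

/-- The sets of parameters of the proper faces of the Minkowski sum of two cyclic polytopes. -/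
noncomputable def mixedFaces (d : ℕ) (T₁ T₂ : Finset ℝ) : Finset (Finset ℝ) :=
  topSets (T₁ ∪ T₂) (sideColor T₁) (momentEval d)

variable {d : ℕ} {T₁ T₂ : Finset ℝ}

lemma sideColor_eq_true {t : ℝ} : sideColor T₁ t = true ↔ t ∈ T₁ := by simp [sideColor]

lemma sideColor_eq_false {t : ℝ} : sideColor T₁ t = false ↔ t ∉ T₁ := by simp [sideColor]

lemma filter_sideColor_true :
    (T₁ ∪ T₂).filter (fun t => sideColor T₁ t = true) = T₁ := by
  ext t; simp only [Finset.mem_filter, Finset.mem_union, sideColor_eq_true]; tauto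

lemma filter_sideColor_false (hdis : Disjoint T₁ T₂) :
    (T₁ ∪ T₂).filter (fun t => sideColor T₁ t = false) = T₂ := by
  ext t
  have : t ∈ T₁ → t ∉ T₂ := fun h => Finset.disjoint_left.1 hdis h
  simp only [Finset.mem_filter, Finset.mem_union, sideColor_eq_false]
  tauto

/-- The faces spanned by the points of one colour are the faces of the polytope of that colour. -/
lemma IsSimplicialSystem.mem_subTopSets_color {V α ι : Type*} [AddCommGroup V] [Module ℝ V]
    [DecidableEq ι] {N : Finset α} {κ : α → ι} {v : α → Module.Dual ℝ V}
    (h : IsSimplicialSystem N κ v) {c : ι} {G : Finset α} (hGc : ∀ t ∈ G, κ t = c) :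
    G ∈ subTopSets N κ v ↔ G ∈ topSets (N.filter fun t => κ t = c) (fun _ => ()) v := by
  rw [mem_topSets, mem_subTopSets]
  constructor
  · rintro ⟨⟨t, ht⟩, p, hp, hG⟩
    obtain ⟨x, h1, h2⟩ := h.exists_peak hp hG
    refine ⟨?_, x, topSet_eq_of ?_ (fun _ _ => ⟨t, ht, rfl⟩) ?_ ?_⟩
    · intro hGN
      obtain ⟨s, hs, hsc, hs'⟩ := h.proper p hp c
      exact hs' (hG (hGN ▸ Finset.mem_filter.2 ⟨hs, hsc⟩))
    · intro s hs
      exact Finset.mem_filter.2 ⟨topSet_subset p (hG hs), hGc s hs⟩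
    · intro s hs t ht _
      exact h1 s hs t ht ((hGc s hs).trans (hGc t ht).symm)
    · intro t ht s hs hs' _
      rw [Finset.mem_filter] at hs
      exact h2 t ht s hs.1 hs' (hs.2.trans (hGc t ht).symm)
  · rintro ⟨hN, p, rfl⟩
    refine ⟨?_, p, ?_, ?_⟩
    · obtain ⟨t, ht, htc⟩ := h.exists_color c
      obtain ⟨s, hs, _⟩ := exists_mem_topSet (N := N.filter fun t => κ t = c) (κ := fun _ => ())
        (v := v) p (c := ()) ⟨t, Finset.mem_filter.2 ⟨ht, htc⟩, rfl⟩
      exact ⟨s, hs⟩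
    · rintro rfl
      exact hN topSet_zero
    · intro t ht
      have ht' := mem_topSet.1 ht
      rw [Finset.mem_filter] at ht'
      refine mem_topSet.2 ⟨ht'.1.1, fun s hs hst => ht'.2 s ?_ rfl⟩
      exact Finset.mem_filter.2 ⟨hs, hst.trans ht'.1.2⟩

lemma isSimplicialSystem_mixed (h₁ : d + 1 ≤ T₁.card) (h₂ : d + 1 ≤ T₂.card)
    (hdis : Disjoint T₁ T₂)
    (hcard : ∀ l ≠ 0, (topSet (T₁ ∪ T₂) (sideColor T₁) (momentEval d) l).card ≤ d + 1) :
    IsSimplicialSystem (T₁ ∪ T₂) (sideColor T₁) (momentEval d) := by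
  refine isSimplicialSystem_momentEval (fun c => ?_) hcard
  cases c
  · rwa [filter_sideColor_false hdis]
  · rwa [filter_sideColor_true]

lemma mixedFaces_color (hsys : IsSimplicialSystem (T₁ ∪ T₂) (sideColor T₁) (momentEval d))
    {F : Finset ℝ} (hF : F ∈ mixedFaces d T₁ T₂) : (∃ t ∈ F, t ∈ T₁) ∧ ∃ t ∈ F, t ∉ T₁ := by
  have := (hsys.mem_topSets_iff.1 hF).2
  refine ⟨?_, ?_⟩
  · obtain ⟨t, ht, h⟩ := this true
    exact ⟨t, ht, sideColor_eq_true.1 h⟩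
  · obtain ⟨t, ht, h⟩ := this false
    exact ⟨t, ht, sideColor_eq_false.1 h⟩

lemma cyclicFaces_subset {m : ℕ} {T F : Finset ℝ} (hF : F ∈ cyclicFaces m T) : F ⊆ T := by
  obtain ⟨_, l, rfl⟩ := mem_topSets.1 hF
  exact topSet_subset l

/-- A nonempty subset of a top set either meets both colours, and is a mixed face, or lies in a
single colour, and is a proper face of that cyclic polytope. -/
lemma cardPoly_subTopSets_mixed (hdis : Disjoint T₁ T₂)
    (hsys : IsSimplicialSystem (T₁ ∪ T₂) (sideColor T₁) (momentEval d)) :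
    cardPoly (subTopSets (T₁ ∪ T₂) (sideColor T₁) (momentEval d)) =
      cardPoly (mixedFaces d T₁ T₂) + cardPoly (cyclicFaces d T₁) +
        cardPoly (cyclicFaces d T₂) := by
  have hm : ∀ G, G ∈ mixedFaces d T₁ T₂ ↔
      G ∈ subTopSets (T₁ ∪ T₂) (sideColor T₁) (momentEval d) ∧ ∀ c, ∃ t ∈ G, sideColor T₁ t = c :=
    fun G => hsys.mem_topSets_iff
  have h1 : ∀ G : Finset ℝ, G ⊆ T₁ → (G ∈ subTopSets (T₁ ∪ T₂) (sideColor T₁) (momentEval d) ↔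
      G ∈ cyclicFaces d T₁) := fun G hG => by
    have := hsys.mem_subTopSets_color (G := G) (c := true)
      fun t ht => sideColor_eq_true.2 (hG ht)
    rwa [filter_sideColor_true] at this
  have h2 : ∀ G : Finset ℝ, (∀ t ∈ G, t ∉ T₁) →
      (G ∈ subTopSets (T₁ ∪ T₂) (sideColor T₁) (momentEval d) ↔ G ∈ cyclicFaces d T₂) :=
    fun G hG => by
      have := hsys.mem_subTopSets_color (G := G) (c := false)
        fun t ht => sideColor_eq_false.2 (hG t ht)
      rwa [filter_sideColor_false hdis] at this
  have hne : ∀ G ∈ subTopSets (T₁ ∪ T₂) (sideColor T₁) (momentEval d), G.Nonempty :=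
    fun G hG => (mem_subTopSets.1 hG).1
  have hdis' : ∀ t ∈ T₂, t ∉ T₁ := fun t ht ht' => Finset.disjoint_left.1 hdis ht' ht
  have hd1 : Disjoint (mixedFaces d T₁ T₂) (cyclicFaces d T₁) := by
    rw [Finset.disjoint_left]
    intro G hG hG1
    obtain ⟨_, t, ht, ht1⟩ := mixedFaces_color hsys hG
    exact ht1 (cyclicFaces_subset hG1 ht)
  have hd2 : Disjoint (mixedFaces d T₁ T₂ ∪ cyclicFaces d T₁) (cyclicFaces d T₂) := by
    rw [Finset.disjoint_left]
    intro G hG hG2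
    have hGT := cyclicFaces_subset hG2
    rcases Finset.mem_union.1 hG with hG | hG
    · obtain ⟨⟨t, ht, ht1⟩, _⟩ := mixedFaces_color hsys hG
      exact hdis' t (hGT ht) ht1
    · have hG1 := cyclicFaces_subset hG
      obtain ⟨t, ht⟩ := hne G ((h1 G hG1).2 hG)
      exact hdis' t (hGT ht) (hG1 ht)
  have hunion : subTopSets (T₁ ∪ T₂) (sideColor T₁) (momentEval d) =
      (mixedFaces d T₁ T₂ ∪ cyclicFaces d T₁) ∪ cyclicFaces d T₂ := by
    ext G
    simp only [Finset.mem_union]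
    constructor
    · intro hG
      by_cases ha : ∀ t ∈ G, t ∉ T₁
      · exact Or.inr ((h2 G ha).1 hG)
      · by_cases hb : G ⊆ T₁
        · exact Or.inl (Or.inr ((h1 G hb).1 hG))
        · refine Or.inl (Or.inl ((hm G).2 ⟨hG, fun c => ?_⟩))
          push Not at ha
          rw [Finset.not_subset] at hb
          cases c
          · obtain ⟨t, ht, ht'⟩ := hb
            exact ⟨t, ht, sideColor_eq_false.2 ht'⟩
          · obtain ⟨t, ht, ht'⟩ := ha
            exact ⟨t, ht, sideColor_eq_true.2 ht'⟩
    · rintro ((hG | hG) | hG)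
      · exact ((hm G).1 hG).1
      · exact (h1 G (cyclicFaces_subset hG)).2 hG
      · exact (h2 G fun t ht => hdis' t (cyclicFaces_subset hG ht)).2 hG
  rw [hunion, cardPoly, Finset.sum_union hd2, Finset.sum_union hd1]
  rfl

lemma mixed_dehnSommerville (hdis : Disjoint T₁ T₂)
    (hsys : IsSimplicialSystem (T₁ ∪ T₂) (sideColor T₁) (momentEval d)) :
    (cardPoly (mixedFaces d T₁ T₂)).comp (-1 - X) =
      (-1) ^ (d + 2) * ((-1) ^ d - 1 - (cardPoly (mixedFaces d T₁ T₂) +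
        cardPoly (cyclicFaces d T₁) + cardPoly (cyclicFaces d T₂))) := by
  have := hsys.dehnSommerville
  rwa [finrank_dual_fin, cardPoly_subTopSets_mixed hdis hsys, Fintype.card_bool] at this

/-- By inclusion-exclusion the first terms count the subsets of `T₁ ∪ T₂` meeting both colours, the
1 correcting for the empty set removed twice. All such subsets with at most `e` elements are mixed
faces. -/
lemma mixed_neighborly (h₁ : d + 1 ≤ T₁.card) (hdis : Disjoint T₁ T₂)
    (hsys : IsSimplicialSystem (T₁ ∪ T₂) (sideColor T₁) (momentEval d)) {e : ℕ}
    (he : 2 * e ≤ d) :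
    X ^ (e + 1) ∣ (1 + X) ^ (T₁.card + T₂.card) + 1 - (1 + X) ^ T₁.card - (1 + X) ^ T₂.card -
      cardPoly (mixedFaces d T₁ T₂) := by
  have hdis' : ∀ t ∈ T₂, t ∉ T₁ := fun t ht ht' => Finset.disjoint_left.1 hdis ht' ht
  have hinter : T₁.powerset ∩ T₂.powerset = {∅} := by
    ext G
    simp only [Finset.mem_inter, Finset.mem_powerset, Finset.mem_singleton]
    constructor
    · rintro ⟨ha, hb⟩
      rw [Finset.eq_empty_iff_forall_notMem]
      exact fun t ht => hdis' t (hb ht) (ha ht)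
    · rintro rfl; simp
  have hsub : T₁.powerset ∪ T₂.powerset ⊆ (T₁ ∪ T₂).powerset :=
    Finset.union_subset (Finset.powerset_mono.2 Finset.subset_union_left)
      (Finset.powerset_mono.2 Finset.subset_union_right)
  have h3 := Finset.sum_union_inter (s₁ := T₁.powerset) (s₂ := T₂.powerset)
    (f := fun F => (X : ℤ[X]) ^ F.card)
  have h4 := Finset.sum_sdiff hsub (f := fun F => (X : ℤ[X]) ^ F.card)
  rw [hinter, Finset.sum_singleton, Finset.card_empty, pow_zero] at h3
  have e1 := cardPoly_powerset T₁
  have e2 := cardPoly_powerset T₂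
  have e3 := cardPoly_powerset (T₁ ∪ T₂)
  rw [Finset.card_union_of_disjoint hdis] at e3
  rw [cardPoly] at e1 e2 e3
  have key : (1 + X : ℤ[X]) ^ (T₁.card + T₂.card) + 1 - (1 + X) ^ T₁.card - (1 + X) ^ T₂.card =
      cardPoly ((T₁ ∪ T₂).powerset \ (T₁.powerset ∪ T₂.powerset)) := by
    rw [cardPoly]
    linear_combination - e3 + e1 + e2 + h3 - h4
  rw [key]
  refine cardPoly_sub_dvd ?_ ?_
  · intro F hF
    obtain ⟨⟨s, hs, hs1⟩, t, ht, ht1⟩ := mixedFaces_color hsys hF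
    obtain ⟨_, l, rfl⟩ := mem_topSets.1 hF
    simp only [Finset.mem_sdiff, Finset.mem_union, Finset.mem_powerset, not_or]
    exact ⟨topSet_subset l, fun h => ht1 (h ht), fun h => hdis' s (h hs) hs1⟩
  · intro F hF hFe
    simp only [Finset.mem_sdiff, Finset.mem_union, Finset.mem_powerset, not_or,
      Finset.not_subset] at hF
    obtain ⟨hFN, ⟨t, ht, ht1⟩, s, hs, hs2⟩ := hF
    have hs1 : s ∈ T₁ := (Finset.mem_union.1 (hFN hs)).resolve_right hs2
    refine mem_topSets_of_two_mul_card_le (by omega) hFN (fun u _ => ?_) ?_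
    · cases hu : sideColor T₁ u
      · exact ⟨t, ht, sideColor_eq_false.2 ht1⟩
      · exact ⟨s, hs, sideColor_eq_true.2 hs1⟩
    · rw [Finset.card_union_of_disjoint hdis]; omega

end TwoColors

end MomentCurve

/-! ### Polynomials under X ↦ -1-X and the neighborly g-polynomial -/

section GPolynomial

open Polynomial

/-- The substitution `X ↦ -1 - X` is an involution of `ℤ[X]`. -/
lemma comp_neg_one_sub_X_comp (p : ℤ[X]) : (p.comp (-1 - X)).comp (-1 - X) = p := by
  rw [comp_assoc]
  simp

/-- The substitution turns the factor X^(e+1) into (X+1)^(e+1) up to sign. The two are coprime with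
product of degree 2e+2, too large for a nonzero `Q`. `Associated` covers both the symmetric and the
antisymmetric case. -/
lemma eq_zero_of_comp_neg_one_sub_X {Q : ℤ[X]} {e : ℕ} (hdeg : Q.natDegree ≤ 2 * e + 1)
    (hdvd : X ^ (e + 1) ∣ Q) (hQ : Associated (Q.comp (-1 - X)) Q) : Q = 0 := by
  have h1 : (X + 1) ^ (e + 1) ∣ Q := by
    obtain ⟨R, hR⟩ := hdvd
    refine Dvd.dvd.trans ?_ hQ.dvd
    rw [hR, mul_comp, X_pow_comp]
    refine Dvd.dvd.mul_right (pow_dvd_pow_of_dvd ⟨-1, by ring⟩ _) _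
  have hcop : IsCoprime (X ^ (e + 1) : ℤ[X]) ((X + 1) ^ (e + 1)) :=
    IsCoprime.pow ⟨-1, 1, by ring⟩
  have h2 := hcop.mul_dvd hdvd h1
  by_contra hne
  have h3 := natDegree_le_of_dvd h2 hne
  have hX1 : (X + 1 : ℤ[X]).natDegree = 1 := by
    simpa using natDegree_X_add_C (1 : ℤ)
  have hX1' : (X + 1 : ℤ[X]) ≠ 0 := fun h => by rw [h] at hX1; simp at hX1
  rw [natDegree_mul (pow_ne_zero _ X_ne_zero) (pow_ne_zero _ hX1'),
    natDegree_pow, natDegree_pow, hX1, natDegree_X] at h3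
  omega

/-- The contribution of the `g`-vector of a neighborly simplicial `2e`-polytope with `N + 2e + 1`
vertices. -/
noncomputable def gPoly (e N : ℕ) : ℤ[X] :=
  ∑ i ∈ Finset.range (e + 1), (Nat.multichoose N i : ℤ[X]) * (X ^ i * (1 + X) ^ (2 * e + 1 - i))

lemma gPoly_natDegree_le (e N : ℕ) : (gPoly e N).natDegree ≤ 2 * e + 1 := by
  refine natDegree_sum_le_of_forall_le _ _ fun i hi => ?_
  rw [Finset.mem_range] at hi
  compute_degree
  omega

/-- The substitution exchanges X and 1+X up to sign, and the exponents 2e+1-i are all at least e+1.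
-/
lemma gPoly_comp_dvd (e N : ℕ) : X ^ (e + 1) ∣ (gPoly e N).comp (-1 - X) := by
  rw [gPoly, Polynomial.sum_comp]
  refine Finset.dvd_sum fun i hi => ?_
  rw [Finset.mem_range] at hi
  rw [mul_comp, mul_comp, X_pow_comp, pow_comp]
  refine Dvd.dvd.mul_left (Dvd.dvd.mul_left ?_ _) _
  refine (pow_dvd_pow _ (by omega : e + 1 ≤ 2 * e + 1 - i)).trans (pow_dvd_pow_of_dvd ⟨-1, ?_⟩ _)
  simp only [add_comp, one_comp, X_comp]
  ring

/-- Pascal's rule for `multichoose` makes the sum telescope up to its last term. -/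
lemma gPoly_partial_succ (D N : ℕ) : ∀ n ≤ D,
    ∑ i ∈ Finset.range (n + 1), (Nat.multichoose (N + 1) i : ℤ[X]) * (X ^ i * (1 + X) ^ (D - i)) =
      (1 + X) * ∑ i ∈ Finset.range (n + 1), (Nat.multichoose N i : ℤ[X]) *
        (X ^ i * (1 + X) ^ (D - i)) -
      (Nat.multichoose (N + 1) n : ℤ[X]) * (X ^ (n + 1) * (1 + X) ^ (D - n)) := by
  intro n
  induction n with
  | zero => intro _; simp; ring
  | succ n ih =>
    intro hn
    rw [Finset.sum_range_succ, Finset.sum_range_succ _ (n + 1), mul_add, ih (by omega),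
      Nat.multichoose_succ_succ, show D - n = D - (n + 1) + 1 by omega]
    push_cast
    ring

lemma gPoly_succ (e N : ℕ) : gPoly e (N + 1) = (1 + X) * gPoly e N -
    (Nat.multichoose (N + 1) e : ℤ[X]) * (X ^ (e + 1) * (1 + X) ^ (e + 1)) := by
  have := gPoly_partial_succ (2 * e + 1) N e (by omega)
  rwa [show 2 * e + 1 - e = e + 1 by omega] at this

/-- Modulo X^(e+1), raising `N` by one multiplies `gPoly` by 1+X, and at `N = 0` the two sides
agree. Formally this is the series of (1-X/(1+X))^(-N) = (1+X)^N. -/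
lemma gPoly_neighborly (e N : ℕ) : X ^ (e + 1) ∣ (1 + X) ^ (N + 2 * e + 1) - gPoly e N := by
  induction N with
  | zero =>
    have : gPoly e 0 = (1 + X) ^ (2 * e + 1) := by
      rw [gPoly, Finset.sum_range_succ', Finset.sum_eq_zero]
      · simp
      · intro i _
        simp
    rw [this, zero_add, sub_self]
    exact dvd_zero _
  | succ N ih =>
    obtain ⟨R, hR⟩ := ih
    refine ⟨(1 + X) * R + (Nat.multichoose (N + 1) e : ℤ[X]) * (1 + X) ^ (e + 1), ?_⟩
    rw [gPoly_succ]
    linear_combination (1 + X) * hR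

lemma gPoly_coeff (e N k : ℕ) : (gPoly e N).coeff k = ∑ i ∈ Finset.range (e + 1),
    (Nat.multichoose N i : ℤ) * (if i ≤ k then ((2 * e + 1 - i).choose (k - i) : ℤ) else 0) := by
  rw [gPoly, finsetSum_coeff]
  refine Finset.sum_congr rfl fun i _ => ?_
  rw [← C_eq_natCast, coeff_C_mul, coeff_X_pow_mul', coeff_one_add_X_pow]

end GPolynomial

/-! ### Identification of the face polynomials -/

section FaceNumbers

open Polynomial

variable {e : ℕ} {T T₁ T₂ : Finset ℝ}

/-- Both sides are fixed by X ↦ -1-X, have degree at most 2e+1, and agree modulo X^(e+1), where only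
the first `gPoly` counts. The 1 stands for the empty face. -/
lemma cyclicFaces_even (hT : 2 * e + 1 ≤ T.card) :
    cardPoly (cyclicFaces (2 * e) T) + 1 =
      gPoly e (T.card - (2 * e + 1)) + (gPoly e (T.card - (2 * e + 1))).comp (-1 - X) := by
  set g := gPoly e (T.card - (2 * e + 1)) with hg
  have hds := cyclic_dehnSommerville hT
  simp only [pow_succ, pow_mul] at hds
  norm_num at hds
  rw [← sub_eq_zero]
  refine eq_zero_of_comp_neg_one_sub_X (e := e) ?_ ?_ ?_
  · have h1 : (cardPoly (cyclicFaces (2 * e) T)).natDegree ≤ 2 * e + 1 :=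
      (cardPoly_natDegree_le fun F hF => card_le_of_mem_cyclicFaces hF).trans (Nat.le_succ _)
    have h2 : g.natDegree ≤ 2 * e + 1 := gPoly_natDegree_le _ _
    have h3 : (g.comp (-1 - X)).natDegree ≤ 2 * e + 1 := by
      refine natDegree_comp_le.trans ?_
      have : (-1 - X : ℤ[X]).natDegree ≤ 1 := by compute_degree
      nlinarith
    exact (natDegree_sub_le _ _).trans (max_le
      (natDegree_add_le_of_degree_le h1 (natDegree_one.trans_le (Nat.zero_le _)))
      (natDegree_add_le_of_degree_le h2 h3))
  · have h1 := cyclic_neighborly hT (le_refl (2 * e))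
    have h2 := gPoly_neighborly e (T.card - (2 * e + 1))
    rw [add_assoc, Nat.sub_add_cancel hT, ← hg] at h2
    have h3 := gPoly_comp_dvd e (T.card - (2 * e + 1))
    rw [← hg] at h3
    convert dvd_sub (dvd_sub h2 h1) h3 using 1
    ring
  · have : (cardPoly (cyclicFaces (2 * e) T) + 1 - (g + g.comp (-1 - X))).comp (-1 - X) =
        cardPoly (cyclicFaces (2 * e) T) + 1 - (g + g.comp (-1 - X)) := by
      rw [sub_comp, add_comp, add_comp, comp_neg_one_sub_X_comp, hds, one_comp]
      ring
    rw [this]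

/-- The symmetry argument in the antisymmetric case. The 2 collects the empty face missing from
`cyclicFaces` and the empty set in the inclusion-exclusion for mixed faces; under X ↦ -1-X the
defects of the three Dehn-Sommerville systems cancel by `cyclicFaces_even`. -/
theorem mixedFaces_eq (hdis : Disjoint T₁ T₂) (h₁ : 2 * e + 1 ≤ T₁.card)
    (h₂ : 2 * e + 1 ≤ T₂.card) (hT : T.card = T₁.card + T₂.card)
    (hcard : ∀ l ≠ 0, (topSet (T₁ ∪ T₂) (sideColor T₁) (momentEval (2 * e)) l).card ≤ 2 * e + 1) :
    cardPoly (cyclicFaces (2 * e + 1) T) + 2 - cardPoly (mixedFaces (2 * e) T₁ T₂) =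
      gPoly e (T₁.card - (2 * e + 1)) + gPoly e (T₂.card - (2 * e + 1)) := by
  have hsys := isSimplicialSystem_mixed h₁ h₂ hdis hcard
  have hTe : 2 * e + 1 + 1 ≤ T.card := by omega
  have hds := cyclic_dehnSommerville hTe
  have hdm := mixed_dehnSommerville hdis hsys
  simp only [pow_succ, pow_mul] at hds hdm
  norm_num at hds hdm
  have e1 := cyclicFaces_even h₁
  have e2 := cyclicFaces_even h₂
  have n1 := gPoly_neighborly e (T₁.card - (2 * e + 1))
  have n2 := gPoly_neighborly e (T₂.card - (2 * e + 1))
  rw [add_assoc, Nat.sub_add_cancel h₁] at n1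
  rw [add_assoc, Nat.sub_add_cancel h₂] at n2
  have d1 := gPoly_natDegree_le e (T₁.card - (2 * e + 1))
  have d2 := gPoly_natDegree_le e (T₂.card - (2 * e + 1))
  generalize gPoly e (T₁.card - (2 * e + 1)) = g₁ at *
  generalize gPoly e (T₂.card - (2 * e + 1)) = g₂ at *
  rw [← sub_eq_zero]
  refine eq_zero_of_comp_neg_one_sub_X (e := e) ?_ ?_ ?_
  · have c1 : (cardPoly (cyclicFaces (2 * e + 1) T)).natDegree ≤ 2 * e + 1 :=
      cardPoly_natDegree_le fun F hF => card_le_of_mem_cyclicFaces hF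
    have c2 : (cardPoly (mixedFaces (2 * e) T₁ T₂)).natDegree ≤ 2 * e + 1 := by
      refine cardPoly_natDegree_le fun F hF => ?_
      obtain ⟨hN, l, rfl⟩ := mem_topSets.1 hF
      exact hcard l fun hl => hN (hl ▸ topSet_zero)
    compute_degree!
  · have h1 := cyclic_neighborly hTe (by omega : 2 * e ≤ 2 * e + 1)
    have h2 := mixed_neighborly h₁ hdis hsys (le_refl (2 * e))
    rw [hT] at h1
    convert dvd_add (dvd_add (dvd_sub h2 h1) n1) n2 using 1
    ring
  · have : (cardPoly (cyclicFaces (2 * e + 1) T) + 2 - cardPoly (mixedFaces (2 * e) T₁ T₂) -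
        (g₁ + g₂)).comp (-1 - X) = -(cardPoly (cyclicFaces (2 * e + 1) T) + 2 -
          cardPoly (mixedFaces (2 * e) T₁ T₂) - (g₁ + g₂)) := by
      rw [sub_comp, sub_comp, add_comp, add_comp, hds, hdm]
      have : (2 : ℤ[X]).comp (-1 - X) = 2 := ofNat_comp ..
      rw [this]
      linear_combination e1 + e2
    rw [this]
    exact Associated.neg_left (Associated.refl _)

end FaceNumbers

/-! ### Faces of convex hulls and sums in terms of top sets -/

section MaxFace

variable {E : Type*} [AddCommGroup E] [Module ℝ E]

/-- The points of `P` at which `l` is maximal over `P`. -/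
def maxFace (P : Set E) (l : Module.Dual ℝ E) : Set E := {x ∈ P | ∀ y ∈ P, l y ≤ l x}

lemma isFace_iff [TopologicalSpace E] [IsTopologicalAddGroup E] [ContinuousSMul ℝ E] [T2Space E]
    [FiniteDimensional ℝ E] {P F : Set E} :
    IsFace P F ↔ F.Nonempty ∧ ∃ l : Module.Dual ℝ E, F = maxFace P l := by
  refine and_congr_right fun hF => ⟨fun h => ?_, ?_⟩
  · obtain ⟨l, hl⟩ := h hF
    exact ⟨l.toLinearMap, hl⟩
  · rintro ⟨l, hl⟩ _
    exact ⟨LinearMap.toContinuousLinearMap l, hl⟩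

lemma le_of_mem_convexHull {X : Set E} {l : Module.Dual ℝ E} {c : ℝ} (hX : ∀ x ∈ X, l x ≤ c)
    {x : E} (hx : x ∈ convexHull ℝ X) : l x ≤ c :=
  convexHull_min (t := {x | l x ≤ c}) hX (convex_halfSpace_le l.isLinear c) hx

lemma eq_of_mem_convexHull {X : Set E} {l : Module.Dual ℝ E} {c : ℝ} (hX : ∀ x ∈ X, l x = c)
    {x : E} (hx : x ∈ convexHull ℝ X) : l x = c :=
  convexHull_min (t := {x | l x = c}) hX (convex_hyperplane l.isLinear c) hx

/-- A convex combination with positive weights reaches the bound only if each term does, so the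
points satisfying the claim form a convex set containing `X`. -/
lemma mem_convexHull_of_eq_max {X : Set E} {l : Module.Dual ℝ E} {c : ℝ} (hX : ∀ x ∈ X, l x ≤ c)
    {x : E} (hx : x ∈ convexHull ℝ X) (hlx : l x = c) : x ∈ convexHull ℝ {y ∈ X | l y = c} := by
  have key : convexHull ℝ X ⊆ {x | l x ≤ c ∧ (l x = c → x ∈ convexHull ℝ {y ∈ X | l y = c})} := by
    refine convexHull_min (fun y hy => ⟨hX y hy, fun h => subset_convexHull ℝ _ ⟨hy, h⟩⟩) ?_
    rw [convex_iff_forall_pos]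
    rintro y ⟨hy, hy'⟩ z ⟨hz, hz'⟩ a b ha hb hab
    have h1 : l (a • y + b • z) = a * l y + b * l z := by simp
    have hc : a * c + b * c = c := by rw [← add_mul, hab, one_mul]
    have hya := mul_le_mul_of_nonneg_left hy ha.le
    have hzb := mul_le_mul_of_nonneg_left hz hb.le
    refine ⟨by linarith, fun h => ?_⟩
    · rw [h1] at h
      have hyc : l y = c := by
        refine le_antisymm hy (not_lt.1 fun hlt => ?_)
        have := mul_lt_mul_of_pos_left hlt ha
        linarith
      have hzc : l z = c := by
        refine le_antisymm hz (not_lt.1 fun hlt => ?_)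
        have := mul_lt_mul_of_pos_left hlt hb
        linarith
      exact convex_convexHull ℝ _ (hy' hyc) (hz' hzc) ha.le hb.le hab
  exact (key hx).2 hlx

lemma maxFace_convexHull (X : Set E) (l : Module.Dual ℝ E) :
    maxFace (convexHull ℝ X) l = convexHull ℝ (maxFace X l) := by
  ext x
  constructor
  · rintro ⟨hx, hmax⟩
    have h := mem_convexHull_of_eq_max (fun y hy => hmax y (subset_convexHull ℝ _ hy)) hx rfl
    refine convexHull_mono ?_ h
    rintro y ⟨hy, hyx⟩
    exact ⟨hy, fun z hz => hyx ▸ hmax z (subset_convexHull ℝ _ hz)⟩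
  · intro hx
    refine ⟨convexHull_mono (fun y hy => hy.1) hx, fun z hz => ?_⟩
    obtain ⟨y, hy⟩ := convexHull_nonempty_iff.1 ⟨x, hx⟩
    have h1 : l x = l y := eq_of_mem_convexHull
      (fun w hw => (hy.2 w hw.1).antisymm (hw.2 y hy.1)) hx
    rw [h1]
    exact le_of_mem_convexHull hy.2 hz

lemma maxFace_add {P Q : Set E} {l : Module.Dual ℝ E} :
    maxFace (P + Q) l = maxFace P l + maxFace Q l := by
  ext z
  constructor
  · rintro ⟨⟨x, hx, y, hy, rfl⟩, h⟩
    refine ⟨x, ⟨hx, fun x' hx' => ?_⟩, y, ⟨hy, fun y' hy' => ?_⟩, rfl⟩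
    · have := h _ (Set.add_mem_add hx' hy)
      simpa using this
    · have := h _ (Set.add_mem_add hx hy')
      simpa using this
  · rintro ⟨x, hx, y, hy, rfl⟩
    refine ⟨Set.add_mem_add hx.1 hy.1, ?_⟩
    rintro _ ⟨x', hx', y', hy', rfl⟩
    have h1 := hx.2 x' hx'
    have h2 := hy.2 y' hy'
    simp only [map_add]
    linarith

lemma mem_of_maxFace_convexHull_eq_singleton {X : Set E} {l : Module.Dual ℝ E} {x : E}
    (h : maxFace (convexHull ℝ X) l = {x}) : x ∈ X := by
  rw [maxFace_convexHull] at h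
  have hne : (maxFace X l).Nonempty := convexHull_nonempty_iff.1 (h ▸ Set.singleton_nonempty x)
  obtain ⟨y, hy⟩ := hne
  have : y ∈ ({x} : Set E) := h ▸ subset_convexHull ℝ _ hy
  rw [Set.mem_singleton_iff] at this
  exact this ▸ hy.1

/-- `W` is the annihilator of the direction space of `S`. -/
lemma affDim_add_finrank [FiniteDimensional ℝ E] {S : Set E}
    {W : Submodule ℝ (Module.Dual ℝ E)}
    (hW : ∀ l, l ∈ W ↔ ∀ x ∈ S, ∀ y ∈ S, l x = l y) :
    affDim S + Module.finrank ℝ W = Module.finrank ℝ E := by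
  have : W = (vectorSpan ℝ S).dualAnnihilator := by
    ext l
    rw [hW, Submodule.mem_dualAnnihilator, vectorSpan_def]
    constructor
    · intro h w hw
      induction hw using Submodule.span_induction with
      | mem w hw =>
        obtain ⟨x, hx, y, hy, rfl⟩ := hw
        simp [h x hx y hy]
      | zero => simp
      | add a b _ _ ha hb => simp [ha, hb]
      | smul c a _ ha => simp [ha]
    · intro h x hx y hy
      have := h (x -ᵥ y) (Submodule.subset_span (Set.vsub_mem_vsub hx hy))
      simpa [sub_eq_zero] using this
  rw [this, affDim]
  exact Subspace.finrank_add_finrank_dualAnnihilator_eq _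

variable {α : Type*}

/-- Evaluation of linear forms at the points of a family. -/
def evalAt (pt : α → E) (t : α) : Module.Dual ℝ (Module.Dual ℝ E) := Module.Dual.eval ℝ E (pt t)

@[simp] lemma evalAt_apply (pt : α → E) (t : α) (l : Module.Dual ℝ E) :
    evalAt pt t l = l (pt t) := rfl

lemma maxFace_image (pt : α → E) (N : Finset α) (l : Module.Dual ℝ E) :
    maxFace (pt '' N) l = pt '' topSet N (fun _ => ()) (evalAt pt) l := by
  ext x
  constructor
  · rintro ⟨⟨t, ht, rfl⟩, h⟩
    exact ⟨t, mem_topSet.2 ⟨ht, fun s hs _ => h _ ⟨s, hs, rfl⟩⟩, rfl⟩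
  · rintro ⟨t, ht, rfl⟩
    have ht := mem_topSet.1 ht
    refine ⟨⟨t, ht.1, rfl⟩, ?_⟩
    rintro _ ⟨s, hs, rfl⟩
    exact ht.2 s hs rfl

lemma maxFace_convexHull_image (pt : α → E) (N : Finset α) (l : Module.Dual ℝ E) :
    maxFace (convexHull ℝ (pt '' N)) l =
      convexHull ℝ (pt '' topSet N (fun _ => ()) (evalAt pt) l) := by
  rw [maxFace_convexHull, maxFace_image]

/-- A point of the family lies in a face exactly when it belongs to the corresponding top set. -/
lemma mem_convexHull_topSet {pt : α → E} {N : Finset α} {l : Module.Dual ℝ E} {t : α}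
    (ht : t ∈ N) : pt t ∈ convexHull ℝ (pt '' topSet N (fun _ => ()) (evalAt pt) l) ↔
      t ∈ topSet N (fun _ => ()) (evalAt pt) l := by
  refine ⟨fun h => ?_, fun h => subset_convexHull ℝ _ ⟨t, h, rfl⟩⟩
  rw [← maxFace_convexHull_image] at h
  exact mem_topSet.2 ⟨ht, fun s hs _ => h.2 _ (subset_convexHull ℝ _ ⟨s, hs, rfl⟩)⟩

lemma affDim_convexHull_image [FiniteDimensional ℝ E] {pt : α → E} {F : Finset α}
    (hF : F.Nonempty)
    (honto : ∀ y : α → ℝ, ∃ (l : Module.Dual ℝ E) (c : ℝ), ∀ t ∈ F, l (pt t) + c = y t) :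
    affDim (convexHull ℝ (pt '' (F : Set α))) + 1 = F.card := by
  let W : Submodule ℝ (Module.Dual ℝ E) :=
    { carrier := {l | ∀ s ∈ F, ∀ t ∈ F, () = () → evalAt pt s l = evalAt pt t l}
      add_mem' := fun {a b} ha hb s hs t ht h => by
        rw [map_add, map_add, ha s hs t ht h, hb s hs t ht h]
      zero_mem' := by simp
      smul_mem' := fun c a ha s hs t ht h => by rw [map_smul, map_smul, ha s hs t ht h] }
  obtain ⟨t₀, ht₀⟩ := hF
  have h1 := finrank_eqForms (κ := fun _ : α => ()) (v := evalAt pt) (F := F) (W := W)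
    (fun _ => ⟨t₀, ht₀, rfl⟩) (fun y => by
      obtain ⟨l, c, h⟩ := honto y
      exact ⟨l, fun _ => c, h⟩) rfl
  have h2 := affDim_add_finrank (S := convexHull ℝ (pt '' (F : Set α))) (W := W) fun l => by
    constructor
    · intro h x hx y hy
      have hc : ∀ z ∈ pt '' (F : Set α), l z = l (pt t₀) := by
        rintro _ ⟨t, ht, rfl⟩
        exact h t ht t₀ ht₀ rfl
      rw [eq_of_mem_convexHull hc hx, eq_of_mem_convexHull hc hy]
    · intro h s hs t ht _
      exact h _ (subset_convexHull ℝ _ ⟨s, hs, rfl⟩) _ (subset_convexHull ℝ _ ⟨t, ht, rfl⟩)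
  rw [Fintype.card_unit, Subspace.dual_finrank_eq] at h1
  omega

lemma affineIndependent_of_interpolation {pt : α → E} {F : Finset α}
    (honto : ∀ y : α → ℝ, ∃ (l : Module.Dual ℝ E) (c : ℝ), ∀ t ∈ F, l (pt t) + c = y t) :
    AffineIndependent ℝ fun t : F => pt t := by
  classical
  rw [affineIndependent_iff]
  intro s w hw hsum i hi
  obtain ⟨l, c, h⟩ := honto fun t => if t = i then 1 else 0
  have h1 : ∑ e ∈ s, w e * l (pt e) = 0 := by
    have := congrArg l hsum
    simpa using this
  have h2 : ∑ e ∈ s, w e * (l (pt e) + c) = w i := by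
    rw [Finset.sum_congr rfl fun e _ => by rw [h e e.2], Finset.sum_eq_single_of_mem i hi]
    · simp
    · intro b _ hb
      rw [if_neg, mul_zero]
      exact fun h => hb (Subtype.ext h)
  simp only [mul_add, Finset.sum_add_distrib, h1, ← Finset.sum_mul, hw] at h2
  linarith

lemma isSimplex_of_interpolation {pt : α → E} {F : Finset α}
    (honto : ∀ y : α → ℝ, ∃ (l : Module.Dual ℝ E) (c : ℝ), ∀ t ∈ F, l (pt t) + c = y t) :
    IsSimplex (convexHull ℝ (pt '' (F : Set α))) := by
  classical
  refine ⟨F.image pt, ?_, by rw [Finset.coe_image]⟩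
  have h := (affineIndependent_of_interpolation honto).range
  have hr : Set.range (fun t : F => pt t) = ((F.image pt : Finset E) : Set E) := by
    ext x; simp
  rw [hr] at h
  exact h

end MaxFace

/-! ### Face numbers as coefficients of the generating functions -/

section FaceCounts

variable {m d : ℕ} {T T₁ T₂ : Finset ℝ}

lemma evalAt_momentCurve (m : ℕ) : evalAt (momentCurve m) = momentEval m := rfl

lemma affDim_eq_of_forall_eq_zero {E : Type*} [AddCommGroup E] [Module ℝ E]
    [FiniteDimensional ℝ E] {S : Set E}
    (h : ∀ l : Module.Dual ℝ E, (∀ x ∈ S, ∀ y ∈ S, l x = l y) → l = 0) :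
    affDim S = Module.finrank ℝ E := by
  have := affDim_add_finrank (S := S) (W := ⊥) fun l => by
    rw [Submodule.mem_bot]
    exact ⟨by rintro rfl; simp, h l⟩
  simpa using this

lemma affDim_cyclicPolytope (hT : m + 1 ≤ T.card) : affDim (cyclicPolytope m T) = m := by
  rw [affDim_eq_of_forall_eq_zero, Module.finrank_fin_fun]
  intro l h
  by_contra hl
  have := card_le_of_form_eq hl (F := T) fun s hs t ht =>
    h _ (subset_convexHull ℝ _ ⟨s, hs, rfl⟩) _ (subset_convexHull ℝ _ ⟨t, ht, rfl⟩)
  omega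

lemma faceCount_cyclicPolytope (hT : m + 1 ≤ T.card) {k : ℕ} (hk : k < m) :
    faceCount (cyclicPolytope m T) k =
      ((cyclicFaces m T).filter fun F => F.card = k + 1).card := by
  have hsys := isSimplicialSystem_cyclic hT
  have hdim : ∀ F ∈ cyclicFaces m T,
      affDim (convexHull ℝ (momentCurve m '' (F : Set ℝ))) + 1 = F.card := fun F hF => by
    obtain ⟨t, ht, _⟩ := (hsys.mem_topSets_iff.1 hF).2 ()
    exact affDim_convexHull_image ⟨t, ht⟩ fun y =>
      exists_form_interpolating ((card_le_of_mem_cyclicFaces hF).trans (Nat.le_succ m)) y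
  have himage : {F | IsFace (cyclicPolytope m T) F ∧ affDim F = k} =
      (fun F : Finset ℝ => convexHull ℝ (momentCurve m '' (F : Set ℝ))) ''
        ((cyclicFaces m T).filter fun F => F.card = k + 1 : Finset (Finset ℝ)) := by
    ext G
    simp only [Set.mem_ofPred_eq, Set.mem_image, Finset.coe_filter, isFace_iff]
    constructor
    · rintro ⟨⟨_, l, rfl⟩, hG⟩
      have hface := maxFace_convexHull_image (momentCurve m) T l
      have hmem : topSet T (fun _ => ()) (momentEval m) l ∈ cyclicFaces m T := by
        -- The full parameter set would give the polytope itself, of dimension `m > k`.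
        refine mem_topSets.2 ⟨fun hN => ?_, l, rfl⟩
        rw [cyclicPolytope, hface, evalAt_momentCurve, hN] at hG
        have := affDim_cyclicPolytope hT
        rw [cyclicPolytope] at this
        omega
      refine ⟨_, ⟨hmem, ?_⟩, hface.symm⟩
      rw [← hdim _ hmem, ← hG, cyclicPolytope, hface, evalAt_momentCurve]
    · rintro ⟨F, ⟨hF, hFk⟩, rfl⟩
      have h1 := hdim F hF
      obtain ⟨t, ht, _⟩ := (hsys.mem_topSets_iff.1 hF).2 ()
      obtain ⟨_, l, rfl⟩ := mem_topSets.1 hF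
      refine ⟨⟨⟨_, subset_convexHull ℝ _ ⟨t, ht, rfl⟩⟩, l, ?_⟩, by omega⟩
      exact (maxFace_convexHull_image (momentCurve m) T l).symm
  -- A face determines its parameter set, which consists of all parameters whose curve point lies in
  -- it.
  have key : ∀ F F', F ∈ cyclicFaces m T → F' ∈ cyclicFaces m T →
      convexHull ℝ (momentCurve m '' (F : Set ℝ)) =
        convexHull ℝ (momentCurve m '' (F' : Set ℝ)) → F ⊆ F' := by
    intro F F' hF hF' h t ht
    have htT := cyclicFaces_subset hF ht
    obtain ⟨_, l, rfl⟩ := mem_topSets.1 hF'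
    refine (mem_convexHull_topSet (pt := momentCurve m) htT).1 ?_
    have : momentCurve m t ∈ convexHull ℝ (momentCurve m '' (F : Set ℝ)) :=
      subset_convexHull ℝ _ ⟨t, ht, rfl⟩
    rw [h] at this
    exact this
  have hinj : Set.InjOn (fun F : Finset ℝ => convexHull ℝ (momentCurve m '' (F : Set ℝ)))
      ((cyclicFaces m T).filter fun F => F.card = k + 1 : Finset (Finset ℝ)) := by
    intro F hF F' hF' h
    rw [Finset.mem_coe, Finset.mem_filter] at hF hF'
    exact (key F F' hF.1 hF'.1 h).antisymm (key F' F hF'.1 hF.1 h.symm)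
  rw [faceCount, himage, hinj.ncard_image, Set.ncard_coe_finset]

/-- The sum of the polytopes spanned by the points of the two colours. -/
noncomputable def mixedSum (d : ℕ) (T₁ T₂ F : Finset ℝ) : Set (Fin d → ℝ) :=
  convexHull ℝ (momentCurve d '' (F ∩ T₁ : Finset ℝ)) +
    convexHull ℝ (momentCurve d '' (F ∩ T₂ : Finset ℝ))

lemma topSet_mixed_inter_left {V : Type*} [AddCommGroup V] [Module ℝ V]
    (v : ℝ → Module.Dual ℝ V) (l : V) :
    topSet (T₁ ∪ T₂) (sideColor T₁) v l ∩ T₁ = topSet T₁ (fun _ => ()) v l := by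
  ext t
  simp only [Finset.mem_inter, mem_topSet, Finset.mem_union]
  constructor
  · rintro ⟨⟨_, h⟩, ht⟩
    refine ⟨ht, fun s hs _ => h s (Or.inl hs) ?_⟩
    rw [sideColor_eq_true.2 ht, sideColor_eq_true.2 hs]
  · rintro ⟨ht, h⟩
    refine ⟨⟨Or.inl ht, fun s _ hst => h s ?_ trivial⟩, ht⟩
    rw [sideColor_eq_true.2 ht] at hst
    exact sideColor_eq_true.1 hst

lemma topSet_mixed_inter_right (hdis : Disjoint T₁ T₂) {V : Type*} [AddCommGroup V] [Module ℝ V]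
    (v : ℝ → Module.Dual ℝ V) (l : V) :
    topSet (T₁ ∪ T₂) (sideColor T₁) v l ∩ T₂ = topSet T₂ (fun _ => ()) v l := by
  have hdis' : ∀ t ∈ T₂, t ∉ T₁ := fun t ht ht' => Finset.disjoint_left.1 hdis ht' ht
  ext t
  simp only [Finset.mem_inter, mem_topSet, Finset.mem_union]
  constructor
  · rintro ⟨⟨_, h⟩, ht⟩
    refine ⟨ht, fun s hs _ => h s (Or.inr hs) ?_⟩
    rw [sideColor_eq_false.2 (hdis' t ht), sideColor_eq_false.2 (hdis' s hs)]
  · rintro ⟨ht, h⟩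
    refine ⟨⟨Or.inr ht, fun s hs hst => h s ?_ trivial⟩, ht⟩
    rw [sideColor_eq_false.2 (hdis' t ht)] at hst
    exact hs.resolve_left (sideColor_eq_false.1 hst)

lemma maxFace_add_cyclicPolytope (hdis : Disjoint T₁ T₂) (l : Module.Dual ℝ (Fin d → ℝ)) :
    maxFace (cyclicPolytope d T₁ + cyclicPolytope d T₂) l =
      mixedSum d T₁ T₂ (topSet (T₁ ∪ T₂) (sideColor T₁) (momentEval d) l) := by
  rw [maxFace_add, mixedSum, topSet_mixed_inter_left, topSet_mixed_inter_right hdis,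
    cyclicPolytope, cyclicPolytope, maxFace_convexHull_image, maxFace_convexHull_image]
  rfl

lemma forall_mem_mixedSum_eq_iff {F : Finset ℝ} (h₁ : (F ∩ T₁).Nonempty) (h₂ : (F ∩ T₂).Nonempty)
    (l : Module.Dual ℝ (Fin d → ℝ)) :
    (∀ x ∈ mixedSum d T₁ T₂ F, ∀ y ∈ mixedSum d T₁ T₂ F, l x = l y) ↔
      (∀ s ∈ F ∩ T₁, ∀ t ∈ F ∩ T₁, l (momentCurve d s) = l (momentCurve d t)) ∧
        ∀ s ∈ F ∩ T₂, ∀ t ∈ F ∩ T₂, l (momentCurve d s) = l (momentCurve d t) := by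
  obtain ⟨a, ha⟩ := h₁
  obtain ⟨b, hb⟩ := h₂
  have hmem : ∀ s ∈ F ∩ T₁, ∀ t ∈ F ∩ T₂,
      momentCurve d s + momentCurve d t ∈ mixedSum d T₁ T₂ F := fun s hs t ht =>
    Set.add_mem_add (subset_convexHull ℝ _ ⟨s, hs, rfl⟩) (subset_convexHull ℝ _ ⟨t, ht, rfl⟩)
  constructor
  · intro h
    refine ⟨fun s hs t ht => ?_, fun s hs t ht => ?_⟩
    · simpa using h _ (hmem s hs b hb) _ (hmem t ht b hb)
    · simpa using h _ (hmem a ha s hs) _ (hmem a ha t ht)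
  · rintro ⟨h1, h2⟩
    have hc : ∀ x ∈ mixedSum d T₁ T₂ F, l x = l (momentCurve d a) + l (momentCurve d b) := by
      rintro _ ⟨x, hx, y, hy, rfl⟩
      have e1 : l x = l (momentCurve d a) := eq_of_mem_convexHull
        (by rintro _ ⟨t, ht, rfl⟩; exact h1 t ht a ha) hx
      have e2 : l y = l (momentCurve d b) := eq_of_mem_convexHull
        (by rintro _ ⟨t, ht, rfl⟩; exact h2 t ht b hb) hy
      simp [e1, e2]
    intro x hx y hy
    rw [hc x hx, hc y hy]

/-- The dimension count of `finrank_eqForms` with two colours; each colour costs one, hence the 2.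
-/
lemma affDim_mixedSum (hdis : Disjoint T₁ T₂) {F : Finset ℝ} (hFN : F ⊆ T₁ ∪ T₂)
    (hF : F.card ≤ d + 1) (h₁ : (F ∩ T₁).Nonempty) (h₂ : (F ∩ T₂).Nonempty) :
    affDim (mixedSum d T₁ T₂ F) + 2 = F.card := by
  have hdis' : ∀ t ∈ T₂, t ∉ T₁ := fun t ht ht' => Finset.disjoint_left.1 hdis ht' ht
  let W : Submodule ℝ (Module.Dual ℝ (Fin d → ℝ)) :=
    { carrier := {l | ∀ s ∈ F, ∀ t ∈ F, sideColor T₁ s = sideColor T₁ t →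
        momentEval d s l = momentEval d t l}
      add_mem' := fun {a b} ha hb s hs t ht h => by
        rw [map_add, map_add, ha s hs t ht h, hb s hs t ht h]
      zero_mem' := by simp
      smul_mem' := fun c a ha s hs t ht h => by rw [map_smul, map_smul, ha s hs t ht h] }
  have e1 := finrank_eqForms (κ := sideColor T₁) (v := momentEval d) (F := F) (W := W)
    (fun c => by
      obtain ⟨a, ha⟩ := h₁
      obtain ⟨b, hb⟩ := h₂
      rw [Finset.mem_inter] at ha hb
      cases c
      · exact ⟨b, hb.1, sideColor_eq_false.2 (hdis' b hb.2)⟩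
      · exact ⟨a, ha.1, sideColor_eq_true.2 ha.2⟩) (fun y => by
      obtain ⟨l, c, h⟩ := exists_form_interpolating hF y
      exact ⟨l, fun _ => c, h⟩) rfl
  have e2 := affDim_add_finrank (S := mixedSum d T₁ T₂ F) (W := W) fun l => by
    rw [forall_mem_mixedSum_eq_iff h₁ h₂]
    simp only [Finset.mem_inter]
    constructor
    · intro h
      refine ⟨fun s hs t ht => h s hs.1 t ht.1 ?_, fun s hs t ht => h s hs.1 t ht.1 ?_⟩
      · rw [sideColor_eq_true.2 hs.2, sideColor_eq_true.2 ht.2]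
      · rw [sideColor_eq_false.2 (hdis' s hs.2), sideColor_eq_false.2 (hdis' t ht.2)]
    · rintro ⟨h1, h2⟩ s hs t ht hst
      have hsN := Finset.mem_union.1 (hFN hs)
      have htN := Finset.mem_union.1 (hFN ht)
      cases hc : sideColor T₁ t
      · rw [hc] at hst
        exact h2 s ⟨hs, hsN.resolve_left (sideColor_eq_false.1 hst)⟩ t
          ⟨ht, htN.resolve_left (sideColor_eq_false.1 hc)⟩
      · rw [hc] at hst
        exact h1 s ⟨hs, sideColor_eq_true.1 hst⟩ t ⟨ht, sideColor_eq_true.1 hc⟩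
  rw [Fintype.card_bool, Subspace.dual_finrank_eq] at e1
  omega

lemma affDim_add_cyclicPolytope (h₁ : d + 1 ≤ T₁.card) (h₂ : d + 1 ≤ T₂.card) :
    affDim (cyclicPolytope d T₁ + cyclicPolytope d T₂) = d := by
  rw [affDim_eq_of_forall_eq_zero, Module.finrank_fin_fun]
  intro l h
  by_contra hl
  obtain ⟨b, hb⟩ := Finset.card_pos.1 ((Nat.succ_pos d).trans_le h₂)
  have := card_le_of_form_eq hl (F := T₁) fun s hs t ht => by
    have hb' := subset_convexHull ℝ (momentCurve d '' (T₂ : Set ℝ)) ⟨b, hb, rfl⟩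
    simpa using h _ (Set.add_mem_add (subset_convexHull ℝ _ ⟨s, hs, rfl⟩) hb') _
      (Set.add_mem_add (subset_convexHull ℝ _ ⟨t, ht, rfl⟩) hb')
  omega

lemma faceCount_add_cyclicPolytope (h₁ : d + 1 ≤ T₁.card) (h₂ : d + 1 ≤ T₂.card)
    (hdis : Disjoint T₁ T₂)
    (hcard : ∀ l ≠ 0, (topSet (T₁ ∪ T₂) (sideColor T₁) (momentEval d) l).card ≤ d + 1)
    {k : ℕ} (hk : k < d) :
    faceCount (cyclicPolytope d T₁ + cyclicPolytope d T₂) k =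
      ((mixedFaces d T₁ T₂).filter fun F => F.card = k + 2).card := by
  have hsys := isSimplicialSystem_mixed h₁ h₂ hdis hcard
  have hdis' : ∀ t ∈ T₂, t ∉ T₁ := fun t ht ht' => Finset.disjoint_left.1 hdis ht' ht
  have hsub : ∀ F ∈ mixedFaces d T₁ T₂, F ⊆ T₁ ∪ T₂ := fun F hF => by
    obtain ⟨_, l, rfl⟩ := mem_topSets.1 hF
    exact topSet_subset l
  have hne₁ : ∀ F ∈ mixedFaces d T₁ T₂, (F ∩ T₁).Nonempty := fun F hF => by
    obtain ⟨⟨t, ht, ht1⟩, _⟩ := mixedFaces_color hsys hF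
    exact ⟨t, Finset.mem_inter.2 ⟨ht, ht1⟩⟩
  have hne₂ : ∀ F ∈ mixedFaces d T₁ T₂, (F ∩ T₂).Nonempty := fun F hF => by
    obtain ⟨_, t, ht, ht1⟩ := mixedFaces_color hsys hF
    exact ⟨t, Finset.mem_inter.2 ⟨ht, (Finset.mem_union.1 (hsub F hF ht)).resolve_left ht1⟩⟩
  have hdim : ∀ F ∈ mixedFaces d T₁ T₂, affDim (mixedSum d T₁ T₂ F) + 2 = F.card := fun F hF => by
    refine affDim_mixedSum hdis (hsub F hF) ?_ (hne₁ F hF) (hne₂ F hF)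
    obtain ⟨hN, l, rfl⟩ := mem_topSets.1 hF
    exact hcard l fun hl => hN (hl ▸ topSet_zero)
  have himage : {F | IsFace (cyclicPolytope d T₁ + cyclicPolytope d T₂) F ∧ affDim F = k} =
      mixedSum d T₁ T₂ ''
        ((mixedFaces d T₁ T₂).filter fun F => F.card = k + 2 : Finset (Finset ℝ)) := by
    ext G
    simp only [Set.mem_ofPred_eq, Set.mem_image, Finset.coe_filter, isFace_iff]
    constructor
    · rintro ⟨⟨_, l, rfl⟩, hG⟩
      have hface := maxFace_add_cyclicPolytope hdis l
      have hmem : topSet (T₁ ∪ T₂) (sideColor T₁) (momentEval d) l ∈ mixedFaces d T₁ T₂ := by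
        refine mem_topSets.2 ⟨fun hN => ?_, l, rfl⟩
        have hl := hsys.topSet_eq_iff.1 hN
        have h0 : maxFace (cyclicPolytope d T₁ + cyclicPolytope d T₂) l =
            cyclicPolytope d T₁ + cyclicPolytope d T₂ := by
          subst hl; ext; simp [maxFace]
        rw [h0, affDim_add_cyclicPolytope h₁ h₂] at hG
        omega
      refine ⟨_, ⟨hmem, ?_⟩, hface.symm⟩
      rw [← hdim _ hmem, ← hG, hface]
    · rintro ⟨F, ⟨hF, hFk⟩, rfl⟩
      have e1 := hdim F hF
      obtain ⟨a, ha⟩ := hne₁ F hF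
      obtain ⟨b, hb⟩ := hne₂ F hF
      obtain ⟨_, l, rfl⟩ := mem_topSets.1 hF
      refine ⟨⟨⟨_, Set.add_mem_add (subset_convexHull ℝ _ ⟨a, ha, rfl⟩)
        (subset_convexHull ℝ _ ⟨b, hb, rfl⟩)⟩, l, ?_⟩, by omega⟩
      exact (maxFace_add_cyclicPolytope hdis l).symm
  have key : ∀ F F', F ∈ mixedFaces d T₁ T₂ → F' ∈ mixedFaces d T₁ T₂ →
      mixedSum d T₁ T₂ F = mixedSum d T₁ T₂ F' → F ⊆ F' := by
    intro F F' hF hF' h t ht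
    have htN := hsub F hF ht
    obtain ⟨a, ha⟩ := hne₁ F hF
    obtain ⟨b, hb⟩ := hne₂ F hF
    obtain ⟨_, l, rfl⟩ := mem_topSets.1 hF'
    rw [← maxFace_add_cyclicPolytope hdis] at h
    have hmem : ∀ A : Finset ℝ, ∀ s ∈ A,
        momentCurve d s ∈ convexHull ℝ (momentCurve d '' (A : Set ℝ)) :=
      fun A s hs => subset_convexHull ℝ _ ⟨s, hs, rfl⟩
    -- A face of the sum only compares sums of a point of each colour; holding one summand fixed
    -- then gives maximality within the other colour.
    have hmax : ∀ a ∈ F ∩ T₁, ∀ b ∈ F ∩ T₂, ∀ s ∈ T₁, ∀ u ∈ T₂,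
        l (momentCurve d s) + l (momentCurve d u) ≤
          l (momentCurve d a) + l (momentCurve d b) := by
      intro a ha b hb s hs u hu
      have h1 : momentCurve d a + momentCurve d b ∈
          maxFace (cyclicPolytope d T₁ + cyclicPolytope d T₂) l :=
        h ▸ Set.add_mem_add (hmem _ a ha) (hmem _ b hb)
      simpa using h1.2 _ (Set.add_mem_add (hmem T₁ s hs) (hmem T₂ u hu))
    refine mem_topSet.2 ⟨htN, fun s hs hst => ?_⟩
    rw [Finset.mem_union] at htN hs
    cases hc : sideColor T₁ t
    · rw [hc] at hst
      have h1 := hmax a ha t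
        (Finset.mem_inter.2 ⟨ht, htN.resolve_left (sideColor_eq_false.1 hc)⟩) a
        (Finset.mem_inter.1 ha).2 s (hs.resolve_left (sideColor_eq_false.1 hst))
      simpa using h1
    · rw [hc] at hst
      have h1 := hmax t (Finset.mem_inter.2 ⟨ht, sideColor_eq_true.1 hc⟩) b hb s
        (sideColor_eq_true.1 hst) b (Finset.mem_inter.1 hb).2
      simpa using h1
  have hinj : Set.InjOn (mixedSum d T₁ T₂)
      ((mixedFaces d T₁ T₂).filter fun F => F.card = k + 2 : Finset (Finset ℝ)) := by
    intro F hF F' hF' h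
    rw [Finset.mem_coe, Finset.mem_filter] at hF hF'
    exact (key F F' hF.1 hF'.1 h).antisymm (key F' F hF'.1 hF.1 h.symm)
  rw [faceCount, himage, hinj.ncard_image, Set.ncard_coe_finset]

end FaceCounts

/-! ### The Cayley polytope: neighborliness and simplicial faces -/

section Cayley

variable {d : ℕ} {T₁ T₂ : Finset ℝ}

/-- The vertex of the Cayley polytope with parameter `t`. -/
noncomputable def cayleyPoint (d : ℕ) (T₁ : Finset ℝ) (t : ℝ) : Fin (d + 1) → ℝ :=
  Fin.snoc (momentCurve d t) (if t ∈ T₁ then 0 else 1)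

/-- The embedding of `ℝ^d` at height `c`, as an affine map. -/
def snocAffine (d : ℕ) (c : ℝ) : (Fin d → ℝ) →ᵃ[ℝ] (Fin (d + 1) → ℝ) where
  toFun x := Fin.snoc x c
  linear :=
    { toFun := fun x => Fin.snoc x 0
      map_add' := fun x y => by
        ext i
        refine Fin.lastCases ?_ (fun i => ?_) i <;> simp
      map_smul' := fun a x => by
        ext i
        refine Fin.lastCases ?_ (fun i => ?_) i <;> simp }
  map_vadd' x y := by
    ext i
    refine Fin.lastCases ?_ (fun i => ?_) i <;> simp

lemma liftAt_convexHull (c : ℝ) (X : Set (Fin d → ℝ)) :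
    liftAt c (convexHull ℝ X) = convexHull ℝ (liftAt c X) :=
  (snocAffine d c).image_convexHull X

lemma liftAt_zero_image {A : Finset ℝ} (hA : A ⊆ T₁) :
    liftAt 0 (momentCurve d '' (A : Set ℝ)) = cayleyPoint d T₁ '' A := by
  rw [liftAt, Set.image_image]
  exact Set.image_congr fun t ht => by rw [cayleyPoint, if_pos (hA ht)]

lemma liftAt_one_image {A : Finset ℝ} (hA : Disjoint T₁ A) :
    liftAt 1 (momentCurve d '' (A : Set ℝ)) = cayleyPoint d T₁ '' A := by
  rw [liftAt, Set.image_image]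
  exact Set.image_congr fun t ht => by
    rw [cayleyPoint, if_neg fun h => Finset.disjoint_left.1 hA h ht]

lemma cayleyPolytope_eq (hdis : Disjoint T₁ T₂) :
    cayleyPolytope (cyclicPolytope d T₁) (cyclicPolytope d T₂) =
      convexHull ℝ (cayleyPoint d T₁ '' (T₁ ∪ T₂ : Finset ℝ)) := by
  rw [cayleyPolytope, cyclicPolytope, cyclicPolytope, liftAt_convexHull, liftAt_convexHull,
    convexHull_convexHull_union_left, convexHull_convexHull_union_right,
    liftAt_zero_image subset_rfl, liftAt_one_image hdis, ← Set.image_union, Finset.coe_union]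

/-- The linear form with linear part `l` and coefficient `h` of the last coordinate. -/
def snocForm (l : Module.Dual ℝ (Fin d → ℝ)) (h : ℝ) : Module.Dual ℝ (Fin (d + 1) → ℝ) :=
  l.comp (LinearMap.funLeft ℝ ℝ Fin.castSucc) + h • LinearMap.proj (Fin.last d)

lemma snocForm_snoc (l : Module.Dual ℝ (Fin d → ℝ)) (h : ℝ) (x : Fin d → ℝ) (c : ℝ) :
    snocForm l h (Fin.snoc x c : Fin (d + 1) → ℝ) = l x + h * c := by
  have : LinearMap.funLeft ℝ ℝ Fin.castSucc (Fin.snoc x c : Fin (d + 1) → ℝ) = x := by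
    ext i; simp [LinearMap.funLeft_apply]
  simp [snocForm, this]

lemma exists_eq_snocForm (L : Module.Dual ℝ (Fin (d + 1) → ℝ)) :
    ∃ (l : Module.Dual ℝ (Fin d → ℝ)) (h : ℝ), L = snocForm l h := by
  refine ⟨L.comp (snocAffine d 0).linear, L (Fin.snoc 0 1 : Fin (d + 1) → ℝ), ?_⟩
  refine LinearMap.ext fun x => ?_
  obtain ⟨y, c, rfl⟩ : ∃ (y : Fin d → ℝ) (c : ℝ), x = (Fin.snoc y c : Fin (d + 1) → ℝ) :=
    ⟨Fin.init x, x (Fin.last d), (Fin.snoc_init_self x).symm⟩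
  have hx : (Fin.snoc y c : Fin (d + 1) → ℝ) =
      (Fin.snoc y 0 : Fin (d + 1) → ℝ) + c • (Fin.snoc 0 1 : Fin (d + 1) → ℝ) := by
    ext i
    refine Fin.lastCases ?_ (fun i => ?_) i <;> simp
  rw [snocForm_snoc, hx, map_add, map_smul, smul_eq_mul, mul_comm]
  rfl

@[simp] lemma snocForm_cayleyPoint (l : Module.Dual ℝ (Fin d → ℝ)) (h t : ℝ) :
    snocForm l h (cayleyPoint d T₁ t) =
      l (momentCurve d t) + h * (if t ∈ T₁ then 0 else 1) := snocForm_snoc _ _ _ _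

lemma cayleyPoint_injective (hd : 0 < d) (T₁ : Finset ℝ) :
    Function.Injective (cayleyPoint d T₁) := by
  intro s t h
  have := congrFun h (Fin.castSucc ⟨0, hd⟩)
  simp only [cayleyPoint, Fin.snoc_castSucc, momentCurve] at this
  simpa using this

lemma cayley_interpolation {F : Finset ℝ} (hF : F.card ≤ d + 1) (y : ℝ → ℝ) :
    ∃ (l : Module.Dual ℝ (Fin (d + 1) → ℝ)) (c : ℝ),
      ∀ t ∈ F, l (cayleyPoint d T₁ t) + c = y t := by
  obtain ⟨l, c, h⟩ := exists_form_interpolating hF y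
  exact ⟨snocForm l 0, c, fun t ht => by simpa using h t ht⟩

/-- A form with zero coefficient on the height ignores which side a point is on, so the maximum over
the curve cuts out `U` on both sides at once. -/
lemma exists_maxFace_cayley {U : Finset ℝ} (hU : 2 * U.card ≤ d) (hne : U.Nonempty)
    (hUN : U ⊆ T₁ ∪ T₂) (hdis : Disjoint T₁ T₂) :
    ∃ L, maxFace (cayleyPolytope (cyclicPolytope d T₁) (cyclicPolytope d T₂)) L =
      convexHull ℝ (cayleyPoint d T₁ '' U) := by
  obtain ⟨l, c, h1, h2⟩ := exists_form_max_on hU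
  refine ⟨snocForm l 0, ?_⟩
  rw [cayleyPolytope_eq hdis, maxFace_convexHull_image]
  congr 3
  obtain ⟨t, ht⟩ := hne
  refine topSet_eq_of hUN (fun _ _ => ⟨t, ht, rfl⟩) (fun s hs t ht _ => ?_)
    fun t ht s _ hs _ => ?_
  · simp [h1 s hs, h1 t ht]
  · simpa [h1 t ht] using h2 s hs

theorem isNeighborly_cayley (hd : 0 < d) (hdis : Disjoint T₁ T₂) :
    IsNeighborly (d / 2) (cayleyPolytope (cyclicPolytope d T₁) (cyclicPolytope d T₂)) := by
  intro S hS hSv hcard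
  have hsub : (S : Set (Fin (d + 1) → ℝ)) ⊆ cayleyPoint d T₁ '' (T₁ ∪ T₂ : Finset ℝ) := by
    intro x hx
    obtain ⟨_, L, hL⟩ := isFace_iff.1 (hSv hx)
    rw [cayleyPolytope_eq hdis] at hL
    exact mem_of_maxFace_convexHull_eq_singleton hL.symm
  obtain ⟨U, hU, rfl⟩ := Finset.subset_set_image_iff.1 hsub
  rw [Finset.coe_subset] at hU
  rw [Finset.card_image_of_injective _ (cayleyPoint_injective hd T₁)] at hcard ⊢
  rw [Finset.image_nonempty] at hS
  obtain ⟨L, hL⟩ := exists_maxFace_cayley (d := d) (by omega) hS hU hdis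
  rw [Finset.coe_image]
  refine ⟨isFace_iff.2 ⟨?_, L, hL.symm⟩, ?_⟩
  · rw [convexHull_nonempty_iff]
    exact hS.to_set.image _
  · exact affDim_convexHull_image hS fun y => cayley_interpolation (by omega) y

/-- As `d ≥ 2`, every `cayleyPoint` is a vertex of the Cayley polytope, hence of any face containing
it, and so a vertex of the simplex. The simplex lies in a level hyperplane of `L`, of dimension d,
and has at most d+1 vertices. -/
lemma card_le_of_isSimplex (hd : 2 ≤ d) (hdis : Disjoint T₁ T₂) {F : Finset ℝ}
    (hF : F ⊆ T₁ ∪ T₂) {L : Module.Dual ℝ (Fin (d + 1) → ℝ)} (hL : L ≠ 0)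
    (hLF : ∀ s ∈ F, ∀ t ∈ F, L (cayleyPoint d T₁ s) = L (cayleyPoint d T₁ t))
    (hsimp : IsSimplex (convexHull ℝ (cayleyPoint d T₁ '' (F : Set ℝ)))) : F.card ≤ d + 1 := by
  classical
  obtain ⟨s, hs, hFs⟩ := hsimp
  have hmem : F.image (cayleyPoint d T₁) ⊆ s := by
    intro x hx
    obtain ⟨t, ht, rfl⟩ := Finset.mem_image.1 hx
    obtain ⟨L', hL'⟩ := exists_maxFace_cayley (d := d) (U := {t}) (by simpa using hd) (by simp)
      (by simpa using hF ht) hdis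
    rw [Finset.coe_singleton, Set.image_singleton, convexHull_singleton] at hL'
    refine mem_of_maxFace_convexHull_eq_singleton (l := L') (X := (s : Set _)) ?_
    rw [← hFs]
    have hsub : convexHull ℝ (cayleyPoint d T₁ '' (F : Set ℝ)) ⊆
        cayleyPolytope (cyclicPolytope d T₁) (cyclicPolytope d T₂) := by
      rw [cayleyPolytope_eq hdis]
      exact convexHull_mono (Set.image_mono (by exact_mod_cast hF))
    have ht' : cayleyPoint d T₁ t ∈ convexHull ℝ (cayleyPoint d T₁ '' (F : Set ℝ)) :=
      subset_convexHull ℝ _ ⟨t, ht, rfl⟩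
    have htm : cayleyPoint d T₁ t ∈
        maxFace (cayleyPolytope (cyclicPolytope d T₁) (cyclicPolytope d T₂)) L' := by
      rw [hL']; rfl
    apply Set.Subset.antisymm
    · rintro x ⟨hx, hxm⟩
      rw [← hL']
      exact ⟨hsub hx, fun y hy => (htm.2 y hy).trans (hxm _ ht')⟩
    · rintro x hx
      rw [Set.mem_singleton_iff] at hx
      subst hx
      exact ⟨ht', fun y hy => htm.2 y (hsub hy)⟩
  have h1 : F.card ≤ s.card := by
    rw [← Finset.card_image_of_injective F (cayleyPoint_injective (by omega : 0 < d) T₁)]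
    exact Finset.card_le_card hmem
  rcases F.eq_empty_or_nonempty with rfl | ⟨t₀, ht₀⟩
  · simp
  have hconst : ∀ x ∈ s, L x = L (cayleyPoint d T₁ t₀) := by
    intro x hx
    refine eq_of_mem_convexHull (X := cayleyPoint d T₁ '' (F : Set ℝ)) ?_ ?_
    · rintro _ ⟨t, ht, rfl⟩
      exact hLF t ht t₀ ht₀
    · rw [hFs]
      exact subset_convexHull ℝ _ hx
  have h2 : vectorSpan ℝ (Set.range ((↑) : s → Fin (d + 1) → ℝ)) ≤ LinearMap.ker L := by
    rw [vectorSpan_def, Submodule.span_le]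
    rintro _ ⟨_, ⟨x, rfl⟩, _, ⟨y, rfl⟩, rfl⟩
    simp [hconst x x.2, hconst y y.2]
  have h3 : Module.finrank ℝ (LinearMap.ker L) < d + 1 := by
    have := Submodule.finrank_lt (s := LinearMap.ker L) fun h => hL (LinearMap.ker_eq_top.1 h)
    rwa [Module.finrank_fin_fun] at this
  have h4 := hs.card_le_finrank_succ
  rw [Fintype.card_coe] at h4
  have h5 := Submodule.finrank_mono h2
  omega

/-- In a Cayley polytope which is simplicial up to its two bases, the mixed faces are simplices. -/
theorem card_topSet_le_of_cayleySimplicial (hd : 2 ≤ d) (h₁ : d + 1 ≤ T₁.card)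
    (h₂ : d + 1 ≤ T₂.card) (hdis : Disjoint T₁ T₂)
    (hsimp : CayleySimplicial (cyclicPolytope d T₁) (cyclicPolytope d T₂))
    (l : Module.Dual ℝ (Fin d → ℝ)) (hl : l ≠ 0) :
    (topSet (T₁ ∪ T₂) (sideColor T₁) (momentEval d) l).card ≤ d + 1 := by
  have hdis' : ∀ t ∈ T₂, t ∉ T₁ := fun t ht ht' => Finset.disjoint_left.1 hdis ht' ht
  set F := topSet (T₁ ∪ T₂) (sideColor T₁) (momentEval d) l with hF
  obtain ⟨a₀, ha₀⟩ := Finset.card_pos.1 ((Nat.succ_pos d).trans_le h₁)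
  obtain ⟨b₀, hb₀⟩ := Finset.card_pos.1 ((Nat.succ_pos d).trans_le h₂)
  obtain ⟨a, ha, hac⟩ := exists_mem_topSet (κ := sideColor T₁) (v := momentEval d) l
    ⟨a₀, Finset.mem_union_left T₂ ha₀, sideColor_eq_true.2 ha₀⟩
  obtain ⟨b, hb, hbc⟩ := exists_mem_topSet (κ := sideColor T₁) (v := momentEval d) l
    ⟨b₀, Finset.mem_union_right T₁ hb₀, sideColor_eq_false.2 (hdis' b₀ hb₀)⟩
  have haT := sideColor_eq_true.1 hac
  have hbT := sideColor_eq_false.1 hbc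
  rw [← hF] at ha hb
  -- The Cayley trick: this height coefficient brings the maxima of `l` over the two sides to a
  -- common level, so the coloured top set of `l` is the ordinary top set of `L`.
  let L := snocForm l (l (momentCurve d a) - l (momentCurve d b))
  have hval : ∀ t ∈ F, L (cayleyPoint d T₁ t) = l (momentCurve d a) := by
    intro t ht
    cases hc : sideColor T₁ t
    · have := eq_of_mem_topSet ht hb (hc.trans hbc.symm)
      simp only [momentEval_apply] at this
      simp [L, sideColor_eq_false.1 hc, this]
    · have := eq_of_mem_topSet ht ha (hc.trans hac.symm)
      simp only [momentEval_apply] at this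
      simp [L, sideColor_eq_true.1 hc, this]
  have hlt : ∀ t ∈ T₁ ∪ T₂, t ∉ F → L (cayleyPoint d T₁ t) < l (momentCurve d a) := by
    intro t htN ht
    cases hc : sideColor T₁ t
    · have := lt_of_mem_topSet hb htN ht (hc.trans hbc.symm)
      simp only [momentEval_apply] at this
      simp only [L, snocForm_cayleyPoint, if_neg (sideColor_eq_false.1 hc)]
      linarith
    · have := lt_of_mem_topSet ha htN ht (hc.trans hac.symm)
      simp only [momentEval_apply] at this
      simpa [L, sideColor_eq_true.1 hc] using this
  have hFN : F ⊆ T₁ ∪ T₂ := topSet_subset l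
  have htop : topSet (T₁ ∪ T₂) (fun _ => ()) (evalAt (cayleyPoint d T₁)) L = F := by
    refine topSet_eq_of hFN (fun _ _ => ⟨a, ha, rfl⟩) (fun s hs t ht _ => ?_)
      fun t ht s hsN hs _ => ?_
    · simp only [evalAt_apply, hval s hs, hval t ht]
    · simp only [evalAt_apply, hval t ht, hlt s hsN hs]
  have hface := maxFace_convexHull_image (cayleyPoint d T₁) (T₁ ∪ T₂) L
  rw [htop, ← cayleyPolytope_eq hdis] at hface
  have hcolor : ∃ s ∈ T₁, s ∉ F := by
    by_contra! h
    have := card_le_of_form_eq hl (F := T₁) fun s hs t ht => by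
      have := eq_of_mem_topSet (h s hs) (h t ht)
        ((sideColor_eq_true.2 hs).trans (sideColor_eq_true.2 ht).symm)
      simpa using this
    omega
  have hmem : ∀ t ∈ F, cayleyPoint d T₁ t ∈ convexHull ℝ (cayleyPoint d T₁ '' (F : Set ℝ)) :=
    fun t ht => subset_convexHull ℝ _ ⟨t, ht, rfl⟩
  have hheight : ∀ c t (P : Set (Fin d → ℝ)), cayleyPoint d T₁ t ∈ liftAt c P →
      (if t ∈ T₁ then 0 else 1) = c := by
    rintro c t P ⟨x, _, hx⟩
    have := congrFun hx (Fin.last d)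
    simpa [cayleyPoint] using this.symm
  refine card_le_of_isSimplex hd hdis hFN (L := L) ?_ (fun s hs t ht => by
    rw [hval s hs, hval t ht]) ?_
  · intro h0
    obtain ⟨s, hs, hs'⟩ := hcolor
    have e1 := hlt s (Finset.mem_union_left _ hs) hs'
    have e2 := hval a ha
    rw [h0] at e1 e2
    simp only [LinearMap.zero_apply] at e1 e2
    exact e1.ne e2
  · refine hsimp _ (isFace_iff.2 ⟨⟨_, hmem a ha⟩, L, hface.symm⟩) ?_ ?_ ?_
    · intro h
      obtain ⟨s, hs, hs'⟩ := hcolor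
      have hsN := Finset.mem_union_left T₂ hs
      rw [← hface, cayleyPolytope_eq hdis, maxFace_convexHull_image] at h
      have := subset_convexHull ℝ (cayleyPoint d T₁ '' (T₁ ∪ T₂ : Finset ℝ)) ⟨s, hsN, rfl⟩
      rw [← h, mem_convexHull_topSet hsN, htop] at this
      exact hs' this
    · intro h
      have := hheight 0 b _ (h ▸ hmem b hb)
      simp [hbT] at this
    · intro h
      have := hheight 1 a _ (h ▸ hmem a ha)
      simp [haT] at this

/-- Write the supporting form as `snocForm l h`. If `l = 0`, the sign of `h` leaves only the bases
and the whole polytope. Otherwise a point maximal overall is maximal in its colour, so the face has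
at most d+1 parameters and interpolation makes it a simplex. -/
theorem cayleySimplicial_of_card_topSet_le (hne₁ : T₁.Nonempty) (hne₂ : T₂.Nonempty)
    (hdis : Disjoint T₁ T₂)
    (hcard : ∀ l ≠ 0, (topSet (T₁ ∪ T₂) (sideColor T₁) (momentEval d) l).card ≤ d + 1) :
    CayleySimplicial (cyclicPolytope d T₁) (cyclicPolytope d T₂) := by
  have hdis' : ∀ t ∈ T₂, t ∉ T₁ := fun t ht ht' => Finset.disjoint_left.1 hdis ht' ht
  intro F hF hP h1 h2
  obtain ⟨_, L, rfl⟩ := isFace_iff.1 hF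
  obtain ⟨l, h, rfl⟩ := exists_eq_snocForm L
  rw [cayleyPolytope_eq hdis, maxFace_convexHull_image] at hP h1 h2 ⊢
  rw [cyclicPolytope, liftAt_convexHull, liftAt_zero_image subset_rfl] at h1
  rw [cyclicPolytope, liftAt_convexHull, liftAt_one_image hdis] at h2
  by_cases hl : l = 0
  · subst hl
    exfalso
    obtain ⟨a, ha⟩ := hne₁
    obtain ⟨b, hb⟩ := hne₂
    rcases lt_trichotomy h 0 with hneg | rfl | hpos
    · refine h1 ?_
      congr 3
      refine topSet_eq_of Finset.subset_union_left (fun _ _ => ⟨a, ha, rfl⟩) (fun s hs t ht _ => ?_)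
        fun t ht s _ hs _ => ?_
      · simp [hs, ht]
      · simpa [hs, ht] using hneg
    · refine hP ?_
      congr 3
      refine topSet_eq_of subset_rfl (fun s hs => ⟨s, hs, rfl⟩) (fun s hs t ht _ => ?_)
        fun t ht s hs hs' _ => absurd hs hs'
      simp
    · refine h2 ?_
      congr 3
      refine topSet_eq_of Finset.subset_union_right (fun _ _ => ⟨b, hb, rfl⟩)
        (fun s hs t ht _ => ?_) fun t ht s hsN hs _ => ?_
      · simp [hdis' s hs, hdis' t ht]
      · simpa [hdis' t ht, (Finset.mem_union.1 hsN).resolve_right hs] using hpos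
  · have hsub : topSet (T₁ ∪ T₂) (fun _ => ()) (evalAt (cayleyPoint d T₁)) (snocForm l h) ⊆
        topSet (T₁ ∪ T₂) (sideColor T₁) (momentEval d) l := by
      intro t ht
      rw [mem_topSet] at ht ⊢
      refine ⟨ht.1, fun s hs hst => ?_⟩
      have := ht.2 s hs rfl
      have hiff : s ∈ T₁ ↔ t ∈ T₁ := by rw [← sideColor_eq_true, hst, sideColor_eq_true]
      simpa [hiff] using this
    exact isSimplex_of_interpolation fun y =>
      cayley_interpolation ((Finset.card_le_card hsub).trans (hcard l hl)) y

/-! ### Rolle's theorem and separated parameter sets -/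

open Polynomial in
/-- Rolle's theorem for a polynomial which is constant on a finite set. -/
lemma exists_roots_derivative {p : ℝ[X]} (hp : p.derivative ≠ 0) {A : Finset ℝ}
    (hA : ∀ s ∈ A, ∀ t ∈ A, p.eval s = p.eval t) :
    ∃ R : Finset ℝ, R ⊆ p.derivative.roots.toFinset ∧ A.card ≤ R.card + 1 ∧
      ∀ r ∈ R, ∃ a ∈ A, ∃ b ∈ A, a < r ∧ r < b := by
  classical
  refine ⟨p.derivative.roots.toFinset.filter fun r => ∃ a ∈ A, ∃ b ∈ A, a < r ∧ r < b,
    Finset.filter_subset _ _, ?_, fun r hr => (Finset.mem_filter.1 hr).2⟩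
  refine Finset.card_le_of_interleaved fun x hx y hy hxy _ => ?_
  obtain ⟨z, hz, hz0⟩ := exists_deriv_eq_zero hxy p.continuousOn (hA x hx y hy)
  rw [Polynomial.deriv] at hz0
  refine ⟨z, ?_, hz⟩
  rw [Finset.mem_filter, Multiset.mem_toFinset, mem_roots hp]
  exact ⟨hz0, x, hx, y, hy, hz⟩

/-- If a and b points are selected on the two sides, Rolle gives at least a-1 and b-1 roots of the
derivative. Separation makes these two sets of roots disjoint, and the derivative has degree below
that of `p`, so a + b ≤ d + 1. -/
lemma card_topSet_le_of_separated (hsep : ∀ s ∈ T₁, ∀ t ∈ T₂, s < t)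
    (l : Module.Dual ℝ (Fin d → ℝ)) (hl : l ≠ 0) :
    (topSet (T₁ ∪ T₂) (sideColor T₁) (momentEval d) l).card ≤ d + 1 := by
  have hdis' : ∀ t ∈ T₂, t ∉ T₁ := fun t ht ht' => lt_irrefl t (hsep t ht' t ht)
  set F := topSet (T₁ ∪ T₂) (sideColor T₁) (momentEval d) l with hF
  have hFN : F ⊆ T₁ ∪ T₂ := topSet_subset l
  obtain ⟨p, hdeg, hder, hp⟩ := exists_polynomial_of_form hl
  have hA : ∀ s ∈ F ∩ T₁, ∀ t ∈ F ∩ T₁, p.eval s = p.eval t := by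
    intro s hs t ht
    rw [Finset.mem_inter] at hs ht
    rw [hp, hp]
    exact eq_of_mem_topSet (v := momentEval d) hs.1 ht.1
      ((sideColor_eq_true.2 hs.2).trans (sideColor_eq_true.2 ht.2).symm)
  have hB : ∀ s ∈ F ∩ T₂, ∀ t ∈ F ∩ T₂, p.eval s = p.eval t := by
    intro s hs t ht
    rw [Finset.mem_inter] at hs ht
    rw [hp, hp]
    exact eq_of_mem_topSet (v := momentEval d) hs.1 ht.1
      ((sideColor_eq_false.2 (hdis' s hs.2)).trans (sideColor_eq_false.2 (hdis' t ht.2)).symm)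
  obtain ⟨R, hR, hRA, hRab⟩ := exists_roots_derivative hder hA
  obtain ⟨R', hR', hRB, hRab'⟩ := exists_roots_derivative hder hB
  have hdisR : Disjoint R R' := by
    rw [Finset.disjoint_left]
    intro r hr hr'
    obtain ⟨_, _, b, hb, _, hrb⟩ := hRab r hr
    obtain ⟨a, ha, _, _, har, _⟩ := hRab' r hr'
    have := hsep b (Finset.mem_inter.1 hb).2 a (Finset.mem_inter.1 ha).2
    linarith
  have h1 : R.card + R'.card ≤ p.derivative.natDegree := by
    rw [← Finset.card_union_of_disjoint hdisR]
    exact (Finset.card_le_card (Finset.union_subset hR hR')).trans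
      ((Multiset.toFinset_card_le _).trans (Polynomial.card_roots' _))
  have h2 : p.derivative.natDegree < p.natDegree := by
    refine Polynomial.natDegree_derivative_lt fun h0 => hder ?_
    rw [Polynomial.natDegree_eq_zero.1 h0 |>.choose_spec.symm, Polynomial.derivative_C]
  have h3 : F.card ≤ (F ∩ T₁).card + (F ∩ T₂).card := by
    have : F = (F ∩ T₁) ∪ (F ∩ T₂) := by
      rw [← Finset.inter_union_distrib_left]
      exact (Finset.inter_eq_left.2 hFN).symm
    calc F.card = ((F ∩ T₁) ∪ (F ∩ T₂)).card := by rw [← this]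
      _ ≤ _ := Finset.card_union_le _ _
  omega

theorem exists_cayleySimplicial (d : ℕ) {n₁ n₂ : ℕ} (h₁ : 0 < n₁) (h₂ : 0 < n₂) :
    ∃ T₁ T₂ : Finset ℝ, T₁.card = n₁ ∧ T₂.card = n₂ ∧ Disjoint T₁ T₂ ∧
      CayleySimplicial (cyclicPolytope d T₁) (cyclicPolytope d T₂) := by
  let T₁ : Finset ℝ := (Finset.range n₁).map Nat.castEmbedding
  let T₂ : Finset ℝ := (Finset.Ico n₁ (n₁ + n₂)).map Nat.castEmbedding
  have c₁ : T₁.card = n₁ := by simp [T₁]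
  have c₂ : T₂.card = n₂ := by simp [T₂]
  have hsep : ∀ s ∈ T₁, ∀ t ∈ T₂, s < t := by
    intro s hs t ht
    obtain ⟨i, hi, rfl⟩ := Finset.mem_map.1 hs
    obtain ⟨j, hj, rfl⟩ := Finset.mem_map.1 ht
    rw [Finset.mem_range] at hi
    rw [Finset.mem_Ico] at hj
    simp only [Nat.castEmbedding_apply, Nat.cast_lt]
    omega
  have hdis : Disjoint T₁ T₂ :=
    Finset.disjoint_left.2 fun t ht ht' => lt_irrefl t (hsep t ht t ht')
  exact ⟨T₁, T₂, c₁, c₂, hdis, cayleySimplicial_of_card_topSet_le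
    (Finset.card_pos.1 (c₁ ▸ h₁)) (Finset.card_pos.1 (c₂ ▸ h₂)) hdis
    fun l hl => card_topSet_le_of_separated hsep l hl⟩

end Cayley

/-! ### Integer binomial coefficients and the main theorem -/

section BinomialCoefficients

lemma binom_natCast (a b : ℕ) (h : a ≤ b) (k : ℕ) :
    binom ((b : ℤ) - a) ((k : ℤ) - a) = if a ≤ k then ((b - a).choose (k - a) : ℤ) else 0 := by
  rw [binom]
  by_cases hk : a ≤ k
  · rw [if_pos (by omega), if_pos hk, show (b : ℤ) - a = ((b - a : ℕ) : ℤ) by omega,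
      show ((k : ℤ) - a).toNat = k - a by omega, Ring.choose_natCast]
  · rw [if_neg (by omega), if_neg hk]

lemma binom_eq_multichoose (N i : ℕ) :
    binom ((N : ℤ) - 1 + i) i = (Nat.multichoose N i : ℤ) := by
  rw [binom, if_pos (by omega), Int.toNat_natCast]
  -- For `N = i = 0` the upper entry is -1, outside the natural-number formula; both sides are 1.
  by_cases h : N + i = 0
  · obtain ⟨rfl, rfl⟩ : N = 0 ∧ i = 0 := by omega
    simp
  · rw [show (N : ℤ) - 1 + i = ((N + i - 1 : ℕ) : ℤ) by omega, Ring.choose_natCast,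
      Nat.multichoose_eq]

end BinomialCoefficients

theorem mainTheorem2 (d : ℕ) (hd : 2 ≤ d) (hev : Even d) :
    (∀ T₁ T₂ : Finset ℝ, d + 1 ≤ T₁.card → d + 1 ≤ T₂.card → Disjoint T₁ T₂ →
      IsNeighborly (d / 2) (cayleyPolytope (cyclicPolytope d T₁) (cyclicPolytope d T₂)) ∧
      (CayleySimplicial (cyclicPolytope d T₁) (cyclicPolytope d T₂) →
        ∀ T : Finset ℝ, T.card = T₁.card + T₂.card →
        ∀ k : ℕ, 1 ≤ k → k ≤ d →
          (faceCount (cyclicPolytope d T₁ + cyclicPolytope d T₂) (k - 1) : ℤ) =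
            (faceCount (cyclicPolytope (d + 1) T) k : ℤ) -
              ∑ i ∈ Finset.range ((d + 1) / 2 + 1),
                binom ((d : ℤ) + 1 - i) ((k : ℤ) + 1 - i) *
                  (binom ((T₁.card : ℤ) - d - 2 + i) i +
                    binom ((T₂.card : ℤ) - d - 2 + i) i))) ∧
    (∀ n₁ n₂ : ℕ, d + 1 ≤ n₁ → d + 1 ≤ n₂ →
      ∃ T₁ T₂ : Finset ℝ, T₁.card = n₁ ∧ T₂.card = n₂ ∧ Disjoint T₁ T₂ ∧
        CayleySimplicial (cyclicPolytope d T₁) (cyclicPolytope d T₂)) := by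
  refine ⟨fun T₁ T₂ h₁ h₂ hdis => ⟨isNeighborly_cayley (by omega) hdis, ?_⟩, fun n₁ n₂ h₁ h₂ =>
    exists_cayleySimplicial d (by omega) (by omega)⟩
  intro hsimp T hT k hk hkd
  have hcard := card_topSet_le_of_cayleySimplicial hd h₁ h₂ hdis hsimp
  rw [faceCount_add_cyclicPolytope h₁ h₂ hdis hcard (by omega : k - 1 < d),
    faceCount_cyclicPolytope (m := d + 1) (by omega) (by omega : k < d + 1),
    show k - 1 + 2 = k + 1 by omega, ← cardPoly_coeff, ← cardPoly_coeff]
  obtain ⟨e, rfl⟩ : ∃ e, d = 2 * e := ⟨d / 2, by obtain ⟨r, rfl⟩ := hev; omega⟩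
  have key := congrArg (fun p => Polynomial.coeff p (k + 1)) (mixedFaces_eq hdis h₁ h₂ hT hcard)
  have h2 : (2 : Polynomial ℤ).coeff (k + 1) = 0 := Polynomial.coeff_ofNat_succ 2 k
  simp only [Polynomial.coeff_add, Polynomial.coeff_sub, gPoly_coeff, h2, add_zero,
    ← Finset.sum_add_distrib] at key
  -- For even d the floor of (d+1)/2 is e, so the sum has the same range as `gPoly`; the constant 2
  -- has disappeared because k+1 > 0.
  rw [eq_sub_iff_add_eq, ← eq_sub_iff_add_eq', key, show (2 * e + 1) / 2 + 1 = e + 1 by omega]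
  refine Finset.sum_congr rfl fun i hi => ?_
  rw [Finset.mem_range] at hi
  have b0 := binom_natCast i (2 * e + 1) (by omega) (k + 1)
  have b1 := binom_eq_multichoose (T₁.card - (2 * e + 1)) i
  have b2 := binom_eq_multichoose (T₂.card - (2 * e + 1)) i
  rw [← b1, ← b2, ← b0]
  push_cast [h₁, h₂]
  ring_nf
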